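/- Let $\mathbb D$ be the open unit disc, $\mathbb T$ the unit circle with normalized Lebesgue measure $m$, $L^p=L^p(\mathbb T,m)$, and let $H^p\subseteq L^p$ ($1\le p\le\infty$) be the Hardy space of functions whose Fourier coefficients of negative index vanish. For $z\in\mathbb D$ put $k_z(\zeta)=(1-\bar z\zeta)^{-1}$ (the Szegő kernel) and, for $f\in H^p$, $f(z)=\int_{\mathbb T} f\,\overline{k_z}\,dm$, the value at $z$ of the holomorphic extension of $f$ to $\mathbb D$. Let $\Gamma$ be a group of holomorphic automorphisms of $\mathbb D$; each $\gamma\in\Gamma$ is of the form $\gamma(z)=\lambda\frac{a-z}{1-\bar a z}$ with $|\lambda|=1$, $|a|<1$, and so acts on $\mathbb T$ as well. For a character $\sigma\in\hat\Gamma$ (a homomorphism $\sigma:\Gamma\to\mathbb T$) let $H^p_\sigma=\{f\in H^p: f\circ\gamma=\sigma(\gamma)f \text{ a.e. on } \mathbb T \text{ for all }\gamma\in\Gamma\}$, and let $H^p_\Gamma$ be this space for the trivial character. The space $H^2_\sigma$, with the inner product of $L^2$, is a reproducing kernel Hilbert space of functions on $\mathbb D$; let $K^\sigma(z,w)=k^\sigma_w(z)$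 be its kernel, where $k^\sigma_w\in H^2_\sigma$ and $f(w)=\langle f,k^\sigma_w\rangle$ for all $f\in H^2_\sigma$. Let $\mathfrak M_\Gamma$ be the $\sigma$-algebra of measurable $E\subseteq\mathbb T$ with $m(E\,\triangle\,\gamma^{-1}(E))=0$ for all $\gamma\in\Gamma$, let $\Psi$ be the conditional expectation onto $\mathfrak M_\Gamma$, let $v_\gamma=-i\,\Psi(k_{\gamma(0)}-\overline{k_{\gamma(0)}})$, and let the defect space of $\Gamma$ be $N=\operatorname{span}\{v_\gamma:\gamma\in\Gamma\}$. The group $\Gamma$ is called admissible if it is of convergence type, that is $\sum_{\gamma\in\Gamma}(1-|\gamma(0)|)<\infty$ (which forces $\Gamma$ to be discrete, i.e. Fuchsian), and $N$ is finite-dimensional. **Theorem.** Let $\Gamma$ be admissible, let $z_1,\dots,z_n\in\mathbb D$ and $w_1,\dots,w_n\in\mathbb C$. There is a function $f\in H^\infty_\Gamma$ with $\|f\|_\infty\le 1$ and $f(z_j)=w_j$ for $j=1,\dots,n$ if and only if, for every character $\sigma\in\hat\Gamma$, the matrix $$A_\sigma=\big[(1-w_i\overline{w_j})\,K^\sigma(z_i,z_j)\big]_{i,j=1}^n$$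 is positive semidefinite. -/

import Mathlib

noncomputable section

open MeasureTheory Complex Metric Set
open scoped ENNReal ComplexConjugate UnitDisc Real

namespace FuchsianHardy

/-- Holomorphic self-maps of the open unit disc. -/
def IsHolo (φ : 𝔻 → 𝔻) : Prop :=
  ∃ F : ℂ → ℂ, DifferentiableOn ℂ F (ball 0 1) ∧ ∀ z : 𝔻, F z = φ z

theorem IsHolo.comp {φ ψ : 𝔻 → 𝔻} (hφ : IsHolo φ) (hψ : IsHolo ψ) : IsHolo (φ ∘ ψ) := by
  obtain ⟨F, hF, hF'⟩ := hφ
  obtain ⟨G, hG, hG'⟩ := hψ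
  refine ⟨F ∘ G, hF.comp hG fun z hz => ?_, fun z => by simp [hG', hF']⟩
  have := hG' (UnitDisc.mk z (by simpa using hz))
  simp only [UnitDisc.coe_mk] at this
  rw [this]
  simpa using UnitDisc.norm_lt_one _

/-- The group of automorphisms of the disc: holomorphic bijections with holomorphic inverse. -/
def DiscAut : Subgroup (Equiv.Perm 𝔻) where
  carrier := {φ | IsHolo φ ∧ IsHolo φ.symm}
  mul_mem' := fun {_ _} ha hb => ⟨ha.1.comp hb.1, hb.2.comp ha.2⟩
  one_mem' := ⟨⟨id, differentiableOn_id, fun _ => rfl⟩, ⟨id, differentiableOn_id, fun _ => rfl⟩⟩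
  inv_mem' := fun {_} ha => ⟨ha.2, ha.1⟩

theorem one_sub_ne {a z : ℂ} (ha : ‖a‖ < 1) (hz : ‖z‖ ≤ 1) : 1 - conj a * z ≠ 0 := by
  intro h
  have h1 : conj a * z = 1 := (sub_eq_zero.1 h).symm
  have h2 : ‖a‖ * ‖z‖ = 1 := by simpa using congrArg norm h1
  nlinarith [norm_nonneg a, norm_nonneg z]

/-- The point `a = φ⁻¹(0)` of an automorphism `φ(z) = λ (a - z) / (1 - conj a * z)`. -/
def center (φ : DiscAut) : 𝔻 := (φ : Equiv.Perm 𝔻).symm 0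

theorem normSq_ident (a z : ℂ) : ‖1 - conj a * z‖ ^ 2 - ‖a - z‖ ^ 2
    = (1 - ‖a‖ ^ 2) * (1 - ‖z‖ ^ 2) := by
  simp only [← Complex.normSq_eq_norm_sq, Complex.normSq_apply]
  simp
  ring

theorem norm_blaschke_lt {a z : ℂ} (ha : ‖a‖ < 1) (hz : ‖z‖ < 1) :
    ‖(a - z) / (1 - conj a * z)‖ < 1 := by
  rw [norm_div, div_lt_one (norm_pos_iff.2 (one_sub_ne ha hz.le))]
  have h := normSq_ident a z
  have : 0 < (1 - ‖a‖ ^ 2) * (1 - ‖z‖ ^ 2) := by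
    apply mul_pos <;> nlinarith [norm_nonneg a, norm_nonneg z]
  exact lt_of_pow_lt_pow_left₀ 2 (norm_nonneg _) (by linarith)

theorem norm_blaschke_eq {a z : ℂ} (ha : ‖a‖ < 1) (hz : ‖z‖ = 1) :
    ‖(a - z) / (1 - conj a * z)‖ = 1 := by
  rw [norm_div, div_eq_one_iff_eq (norm_ne_zero_iff.2 (one_sub_ne ha hz.le))]
  have h := normSq_ident a z
  rw [hz] at h
  exact (pow_left_inj₀ (norm_nonneg _) (norm_nonneg _) two_ne_zero).1 (by linarith)

theorem blaschke_invol {a z : ℂ} (ha : ‖a‖ < 1) (hz : ‖z‖ ≤ 1) :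
    (a - (a - z) / (1 - conj a * z)) / (1 - conj a * ((a - z) / (1 - conj a * z))) = z := by
  have h1 := one_sub_ne ha hz
  have h2 := one_sub_ne ha ha.le
  have e1 : a - (a - z) / (1 - conj a * z) = z * (1 - conj a * a) / (1 - conj a * z) := by
    rw [eq_div_iff h1, sub_mul, div_mul_cancel₀ _ h1]; ring
  have e2 : 1 - conj a * ((a - z) / (1 - conj a * z)) = (1 - conj a * a) / (1 - conj a * z) := by
    rw [eq_div_iff h1, sub_mul, mul_assoc, div_mul_cancel₀ _ h1]; ring
  rw [e1, e2, div_div_div_cancel_right₀ h1, mul_div_cancel_right₀ _ h2]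

theorem diff_blaschke {a : ℂ} (ha : ‖a‖ < 1) :
    DifferentiableOn ℂ (fun z => (a - z) / (1 - conj a * z)) (ball 0 1) := by
  refine DifferentiableOn.div (by fun_prop) (by fun_prop) fun z hz => one_sub_ne ha ?_
  exact (mem_ball_zero_iff.1 hz).le

/-- Blaschke factor as a self-map of the disc. -/
def blaschke (a : 𝔻) (z : 𝔻) : 𝔻 :=
  UnitDisc.mk ((a - z) / (1 - conj (a : ℂ) * z)) (norm_blaschke_lt a.norm_lt_one z.norm_lt_one)

theorem isHolo_blaschke (a : 𝔻) : IsHolo (blaschke a) :=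
  ⟨_, diff_blaschke a.norm_lt_one, fun _ => rfl⟩

theorem blaschke_blaschke (a z : 𝔻) : blaschke a (blaschke a z) = z :=
  UnitDisc.coe_injective (blaschke_invol a.norm_lt_one z.norm_lt_one.le)

theorem IsHolo.schwarz {φ : 𝔻 → 𝔻} (h : IsHolo φ) (h0 : φ 0 = 0) (z : 𝔻) :
    ‖(φ z : ℂ)‖ ≤ ‖(z : ℂ)‖ := by
  obtain ⟨F, hF, hF'⟩ := h
  rw [← hF']
  refine norm_le_norm_of_mapsTo_ball hF (fun w hw => ?_) ?_ z.norm_lt_one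
  · have := hF' (UnitDisc.mk w (by simpa using hw))
    simp only [UnitDisc.coe_mk] at this
    rw [this]
    simpa using (UnitDisc.norm_lt_one _).le
  · simpa [h0] using hF' 0

/-- Every automorphism has the form `z ↦ λ (a - z) / (1 - conj a * z)`, with `a = φ⁻¹(0)`. -/
theorem exists_rotation (φ : DiscAut) : ∃ l : Circle, ∀ z : 𝔻,
    (((φ : Equiv.Perm 𝔻) z : 𝔻) : ℂ)
      = l * ((center φ - z) / (1 - conj (center φ : ℂ) * z)) := by
  set a := center φ with ha
  set ψ : 𝔻 → 𝔻 := (φ : Equiv.Perm 𝔻) ∘ blaschke a with hψ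
  set χ : 𝔻 → 𝔻 := blaschke a ∘ (φ : Equiv.Perm 𝔻).symm with hχ
  have hψh : IsHolo ψ := φ.2.1.comp (isHolo_blaschke a)
  have hχh : IsHolo χ := (isHolo_blaschke a).comp φ.2.2
  have b0 : blaschke a 0 = a := UnitDisc.coe_injective (by simp [blaschke])
  have ba : blaschke a a = 0 := by simpa [b0] using blaschke_blaschke a 0
  have hψ0 : ψ 0 = 0 := by
    rw [hψ, Function.comp_apply, b0, ha, center, Equiv.apply_symm_apply]
  have hχ0 : χ 0 = 0 := by
    have : (φ : Equiv.Perm 𝔻).symm 0 = a := rfl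
    simp [hχ, this, ba]
  have hχψ : ∀ z, χ (ψ z) = z := fun z => by simp [hχ, hψ, blaschke_blaschke]
  have hn : ∀ z, ‖(ψ z : ℂ)‖ = ‖(z : ℂ)‖ := fun z =>
    le_antisymm (hψh.schwarz hψ0 z) (by simpa [hχψ] using hχh.schwarz hχ0 (ψ z))
  obtain ⟨F, hF, hF'⟩ := hψh
  have hF0 : F 0 = 0 := by simpa [hψ0] using hF' 0
  have hmaps : MapsTo F (ball 0 1) (closedBall (F 0) 1) := fun w hw => by
    have := hF' (UnitDisc.mk w (by simpa using hw))
    simp only [UnitDisc.coe_mk] at this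
    rw [this, hF0]
    simpa using (UnitDisc.norm_lt_one _).le
  obtain ⟨C, hC, hFC⟩ := affine_of_mapsTo_ball_of_exists_norm_dslope_eq_div' hF hmaps
    ⟨1 / 2, by simp; norm_num, by
      have := hF' (UnitDisc.mk (1 / 2) (by norm_num))
      have h2 := hn (UnitDisc.mk (1 / 2) (by norm_num))
      rw [← this] at h2
      rw [dslope_of_ne _ (by norm_num), slope_def_field, hF0, sub_zero, sub_zero, norm_div]
      simp only [UnitDisc.coe_mk] at h2
      rw [h2]
      norm_num⟩
  refine ⟨⟨C, by simpa [Submonoid.unitSphere] using hC⟩, fun z => ?_⟩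
  have h1 := hFC (show ((blaschke a z : 𝔻) : ℂ) ∈ ball (0 : ℂ) 1 by
    simpa using (UnitDisc.norm_lt_one _))
  have h2 := hF' (blaschke a z)
  simp only [hψ, Function.comp, blaschke_blaschke] at h2
  rw [← h2, h1, hF0]
  simp [blaschke, mul_comm]

/-- The unimodular constant of an automorphism. -/
def rotation (φ : DiscAut) : Circle := (exists_rotation φ).choose

theorem discAut_apply (φ : DiscAut) (z : 𝔻) : (((φ : Equiv.Perm 𝔻) z : 𝔻) : ℂ)
    = rotation φ * ((center φ - z) / (1 - conj (center φ : ℂ) * z)) :=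
  (exists_rotation φ).choose_spec z

/-- The extension of an automorphism of the disc to the unit circle. -/
def boundaryMap (φ : DiscAut) (ζ : Circle) : Circle :=
  rotation φ * ⟨(center φ - ζ) / (1 - conj (center φ : ℂ) * ζ), by
    simpa [Submonoid.unitSphere] using
      norm_blaschke_eq (center φ).norm_lt_one (Circle.norm_coe ζ)⟩

theorem coe_boundaryMap (φ : DiscAut) (ζ : Circle) : (boundaryMap φ ζ : ℂ)
    = rotation φ * ((center φ - ζ) / (1 - conj (center φ : ℂ) * ζ)) := rfl


/-! ### The circle, its normalized Lebesgue measure and the action on it -/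

instance : MeasurableSpace Circle := borel Circle


instance : BorelSpace Circle := ⟨rfl⟩

theorem continuous_coeCircle : Continuous fun ζ : Circle => (ζ : ℂ) := continuous_subtype_val

theorem two_pi_pos_fact : Fact (0 < 2 * π) := ⟨Real.two_pi_pos⟩

attribute [local instance] two_pi_pos_fact

theorem measurable_toCircle : Measurable (AddCircle.toCircle (T := 2 * π)) :=
  AddCircle.continuous_toCircle.measurable

/-- Normalized Lebesgue measure on the unit circle. -/
def circleMeasure : Measure Circle :=
  (AddCircle.haarAddCircle (T := 2 * π)).map AddCircle.toCircle

instance : IsProbabilityMeasure circleMeasure :=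
  Measure.isProbabilityMeasure_map measurable_toCircle.aemeasurable

theorem circleMeasure_eq_zero_iff {E : Set Circle} (hE : MeasurableSet E) :
    circleMeasure E = 0 ↔ volume (Circle.exp ⁻¹' E ∩ Ioc (-π) π) = 0 := by
  have h1 : MeasurableSet (AddCircle.toCircle (T := 2 * π) ⁻¹' E) := measurable_toCircle hE
  have h2 := (AddCircle.measurePreserving_mk (2 * π) (-π)).measure_preimage h1.nullMeasurableSet
  have h3 : ((↑) : ℝ → AddCircle (2 * π)) ⁻¹' (AddCircle.toCircle (T := 2 * π) ⁻¹' E)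
      = Circle.exp ⁻¹' E := by
    ext x
    simp [AddCircle.toCircle_apply_mk, Real.pi_ne_zero]
  rw [h3, Measure.restrict_apply (Circle.exp.continuous.measurable hE)] at h2
  have h4 : -π + 2 * π = π := by ring
  rw [h4, AddCircle.volume_eq_smul_haarAddCircle] at h2
  rw [circleMeasure, Measure.map_apply measurable_toCircle hE, h2]
  simp [Real.pi_pos]

theorem continuous_boundaryMap (φ : DiscAut) : Continuous (boundaryMap φ) := by
  refine Continuous.subtype_mk (p := fun x : ℂ => x ∈ Submonoid.unitSphere ℂ)
    (f := fun ζ : Circle => (rotation φ : ℂ) *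
      ((center φ - ζ) / (1 - conj (center φ : ℂ) * ζ))) ?_ fun ζ => (boundaryMap φ ζ).2
  refine continuous_const.mul (Continuous.div ?_ ?_ fun ζ => ?_)
  · exact continuous_const.sub continuous_coeCircle
  · exact continuous_const.sub (continuous_const.mul continuous_coeCircle)
  · exact one_sub_ne (center φ).norm_lt_one (Circle.norm_coe ζ).le

theorem quasiMeasurePreserving_boundaryMap (φ : DiscAut) :
    Measure.QuasiMeasurePreserving (boundaryMap φ) circleMeasure circleMeasure := by
  refine ⟨(continuous_boundaryMap φ).measurable, Measure.AbsolutelyContinuous.mk fun E hE h0 => ?_⟩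
  rw [Measure.map_apply (continuous_boundaryMap φ).measurable hE]
  rw [circleMeasure_eq_zero_iff ((continuous_boundaryMap φ).measurable hE)]
  rw [circleMeasure_eq_zero_iff hE] at h0
  set a : ℂ := (center φ : ℂ) with ha
  have han : ‖a‖ < 1 := (center φ).norm_lt_one
  set c : ℂ := conj (rotation φ : ℂ) with hc
  have hcn : ‖c‖ = 1 := by rw [hc, RCLike.norm_conj, Circle.norm_coe]
  let u : ℝ → ℂ := fun s => c * exp (s * I)
  have hun : ∀ s, ‖u s‖ = 1 := fun s => by simp [u, hcn, norm_exp_ofReal_mul_I]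
  let b : ℝ → ℂ := fun s => (a - u s) / (1 - conj a * u s)
  have hb : Differentiable ℝ b := by
    have hu : Differentiable ℝ u := by
      intro s
      exact ((Complex.ofRealCLM.differentiableAt.mul_const I).cexp).const_mul c
    exact Differentiable.div (hu.const_sub a) ((hu.const_mul _).const_sub 1)
      fun s => one_sub_ne han (hun s).le
  let h : ℝ → ℝ := fun s => (log (b s)).im
  set S : Set ℝ := (Circle.exp ⁻¹' E ∩ Ioc (-π) π) ∩ {s | b s ∈ slitPlane} with hS
  have hdiff : DifferentiableOn ℝ h S := by
    intro s hs
    have h1 : DifferentiableAt ℝ log (b s) :=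
      (differentiableAt_log hs.2).restrictScalars ℝ
    exact (Complex.imCLM.differentiableAt.comp s (h1.comp s (hb s))).differentiableWithinAt
  have hnull := addHaar_image_eq_zero_of_differentiableOn_of_addHaar_eq_zero volume hdiff
    (measure_mono_null inter_subset_left h0)
  have hsub : Circle.exp ⁻¹' (boundaryMap φ ⁻¹' E) ∩ Ioc (-π) π ⊆ h '' S ∪ {π} := by
    rintro t ⟨htE, ht⟩
    rcases eq_or_lt_of_le ht.2 with h' | h'
    · exact Or.inr h'
    left
    set w : Circle := boundaryMap φ (Circle.exp t) with hw
    have hexp : Circle.exp (arg w) = w := Circle.exp_arg w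
    have hbs : b (arg w) = exp (t * I) := by
      have e1 : exp ((arg (w : ℂ) : ℝ) * I) = w := by
        rw [← Circle.coe_exp, hexp]
      have e2 : u (arg w) = (a - exp (t * I)) / (1 - conj a * exp (t * I)) := by
        have hrr : c * (rotation φ : ℂ) = 1 := by
          rw [hc, mul_comm, mul_conj]; simp
        simp only [u]
        rw [e1, hw, coe_boundaryMap, ← mul_assoc, hrr, one_mul, Circle.coe_exp]
      simp only [b]
      rw [e2]
      exact blaschke_invol han (norm_exp_ofReal_mul_I t).le
    have hsl : exp (t * I) ∈ slitPlane := by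
      rw [mem_slitPlane_iff_arg, arg_exp_mul_I]
      refine ⟨?_, exp_ne_zero _⟩
      rw [(toIocMod_eq_self _).2 (by constructor <;> linarith [ht.1, ht.2])]
      exact h'.ne
    refine ⟨arg w, ⟨⟨?_, arg_mem_Ioc _⟩, ?_⟩, ?_⟩
    · show Circle.exp (arg w) ∈ E
      rw [hexp]; exact htE
    · show b (arg w) ∈ slitPlane
      rw [hbs]; exact hsl
    · show (log (b (arg w))).im = t
      rw [hbs, log_im, arg_exp_mul_I]
      exact (toIocMod_eq_self _).2 (by constructor <;> linarith [ht.1, ht.2])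
  exact measure_mono_null hsub (measure_union_null hnull (by simp))

/-! ### Hardy spaces and character-automorphic Hardy spaces -/

theorem integrable_mul_of_continuous {p : ℝ≥0∞} [hp : Fact (1 ≤ p)] (f : Lp ℂ p circleMeasure)
    {g : Circle → ℂ} (hg : Continuous g) : Integrable (fun ζ => f ζ * g ζ) circleMeasure := by
  obtain ⟨C, hC⟩ := isCompact_univ.exists_bound_of_continuousOn hg.continuousOn
  exact ((Lp.memLp f).integrable hp.out).mul_bdd (c := C) hg.aestronglyMeasurable
    (Filter.Eventually.of_forall fun x => hC x (mem_univ x))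

theorem integral_add_mul {p : ℝ≥0∞} [Fact (1 ≤ p)] (f f' : Lp ℂ p circleMeasure)
    {g : Circle → ℂ} (hg : Continuous g) :
    ∫ ζ, (f + f') ζ * g ζ ∂circleMeasure
      = ∫ ζ, f ζ * g ζ ∂circleMeasure + ∫ ζ, f' ζ * g ζ ∂circleMeasure := by
  rw [← integral_add (integrable_mul_of_continuous f hg) (integrable_mul_of_continuous f' hg)]
  refine integral_congr_ae ?_
  filter_upwards [Lp.coeFn_add f f'] with ζ h
  rw [h, Pi.add_apply, add_mul]

theorem integral_smul_mul {p : ℝ≥0∞} (c : ℂ) (f : Lp ℂ p circleMeasure) (g : Circle → ℂ) :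
    ∫ ζ, (c • f) ζ * g ζ ∂circleMeasure = c * ∫ ζ, f ζ * g ζ ∂circleMeasure := by
  rw [← integral_const_mul]
  refine integral_congr_ae ?_
  filter_upwards [Lp.coeFn_smul c f] with ζ h
  rw [h, Pi.smul_apply, smul_eq_mul, mul_assoc]

theorem integral_zero_mul {p : ℝ≥0∞} (g : Circle → ℂ) :
    ∫ ζ, (0 : Lp ℂ p circleMeasure) ζ * g ζ ∂circleMeasure = 0 := by
  have h := integral_smul_mul (p := p) 0 0 g
  rwa [zero_smul, zero_mul] at h

theorem continuous_monomial (n : ℕ) : Continuous fun ζ : Circle => (ζ : ℂ) ^ n :=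
  continuous_coeCircle.pow n

/-- The Hardy space `H^p`: functions in `L^p` whose Fourier coefficients of negative index
vanish. -/
def Hardy (p : ℝ≥0∞) [Fact (1 ≤ p)] : Submodule ℂ (Lp ℂ p circleMeasure) where
  carrier := {f | ∀ n : ℕ, 0 < n → ∫ ζ, f ζ * (ζ : ℂ) ^ n ∂circleMeasure = 0}
  add_mem' := fun {f g} hf hg n hn => by
    rw [integral_add_mul f g (continuous_monomial n), hf n hn, hg n hn, add_zero]
  zero_mem' := fun n _ => integral_zero_mul _
  smul_mem' := fun c f hf n hn => by rw [integral_smul_mul, hf n hn, mul_zero]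

/-- The Szegő kernel function `k_z(ζ) = 1 / (1 - conj z * ζ)` on the circle. -/
def szego (z : 𝔻) (ζ : Circle) : ℂ := (1 - conj (z : ℂ) * ζ)⁻¹

theorem continuous_szego (z : 𝔻) : Continuous (szego z) :=
  Continuous.inv₀ (continuous_const.sub (continuous_const.mul continuous_coeCircle))
    fun ζ => one_sub_ne z.norm_lt_one (Circle.norm_coe ζ).le

theorem continuous_conj_szego (z : 𝔻) : Continuous fun ζ => conj (szego z ζ) :=
  continuous_conj.comp (continuous_szego z)

/-- The value `f(z) = ∫ f conj(k_z) dm` at `z ∈ 𝔻` of (the holomorphic extension of) a function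
`f` in a Hardy space. -/
def valueAt (z : 𝔻) (f : Circle → ℂ) : ℂ := ∫ ζ, f ζ * conj (szego z ζ) ∂circleMeasure

/-- The space `H^p_σ` of `f ∈ H^p` with `f ∘ γ = σ(γ) f` for all `γ ∈ Γ`. -/
def HardyChar (p : ℝ≥0∞) [Fact (1 ≤ p)] {Γ : Subgroup DiscAut} (σ : Γ →* Circle) :
    Submodule ℂ (Lp ℂ p circleMeasure) where
  carrier := {f | f ∈ Hardy p ∧
    ∀ γ : Γ, (fun ζ => f (boundaryMap γ ζ)) =ᵐ[circleMeasure] fun ζ => (σ γ : ℂ) * f ζ}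
  add_mem' := fun {f g} hf hg => ⟨add_mem hf.1 hg.1, fun γ => by
    filter_upwards [hf.2 γ, hg.2 γ, Lp.coeFn_add f g,
      (quasiMeasurePreserving_boundaryMap γ).ae (Lp.coeFn_add f g)] with ζ h1 h2 h3 h4
    rw [h4, h3, Pi.add_apply, Pi.add_apply, h1, h2, mul_add]⟩
  zero_mem' := ⟨zero_mem _, fun γ => by
    filter_upwards [Lp.coeFn_zero ℂ p circleMeasure,
      (quasiMeasurePreserving_boundaryMap γ).ae (Lp.coeFn_zero ℂ p circleMeasure)] with ζ h3 h4
    rw [h4, h3]; simp⟩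
  smul_mem' := fun c f hf => ⟨Submodule.smul_mem _ c hf.1, fun γ => by
    filter_upwards [hf.2 γ, Lp.coeFn_smul c f,
      (quasiMeasurePreserving_boundaryMap γ).ae (Lp.coeFn_smul c f)] with ζ h1 h3 h4
    rw [h4, h3, Pi.smul_apply, Pi.smul_apply, h1, smul_eq_mul, smul_eq_mul, mul_left_comm]⟩

/-- The space `H^p_Γ` of `Γ`-invariant functions in `H^p`. -/
abbrev HardyInv (p : ℝ≥0∞) [Fact (1 ≤ p)] (Γ : Subgroup DiscAut) :
    Submodule ℂ (Lp ℂ p circleMeasure) :=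
  HardyChar p (1 : Γ →* Circle)

/-! ### `H^2_σ` as a reproducing kernel Hilbert space on the disc -/

/-- The functional `f ↦ ∫ f g dm` on `L^2`, for continuous `g`. -/
def pairing (g : C(Circle, ℂ)) : Lp ℂ 2 circleMeasure →L[ℂ] ℂ :=
  innerSL ℂ (ContinuousMap.toLp 2 circleMeasure ℂ (star g))

theorem pairing_apply (g : C(Circle, ℂ)) (f : Lp ℂ 2 circleMeasure) :
    pairing g f = ∫ ζ, f ζ * g ζ ∂circleMeasure := by
  rw [pairing, innerSL_apply_apply, L2.inner_def]
  refine integral_congr_ae ?_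
  filter_upwards [ContinuousMap.coeFn_toLp (p := 2) (𝕜 := ℂ) circleMeasure (star g)] with ζ h
  rw [h]
  simp

theorem isClosed_hardyChar {Γ : Subgroup DiscAut} (σ : Γ →* Circle) :
    IsClosed (HardyChar 2 σ : Set (Lp ℂ 2 circleMeasure)) := by
  refine isClosed_of_closure_subset fun f hf => ?_
  obtain ⟨u, hu, hlim⟩ := mem_closure_iff_seq_limit.1 hf
  refine ⟨fun n hn => ?_, fun γ => ?_⟩
  · have h1 := ((pairing ⟨_, continuous_monomial n⟩).continuous.tendsto f).comp hlim
    have h2 : (pairing ⟨_, continuous_monomial n⟩) ∘ u = fun _ => 0 := by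
      funext k
      rw [Function.comp_apply, pairing_apply]
      exact (hu k).1 n hn
    rw [h2, pairing_apply] at h1
    exact (tendsto_nhds_unique h1 tendsto_const_nhds)
  · obtain ⟨ns, -, hns⟩ := (tendstoInMeasure_of_tendsto_Lp hlim).exists_seq_tendsto_ae
    have h1 : ∀ᵐ ζ ∂circleMeasure, ∀ k, u k (boundaryMap γ ζ) = (σ γ : ℂ) * u k ζ :=
      ae_all_iff.2 fun k => (hu k).2 γ
    filter_upwards [hns, h1, (quasiMeasurePreserving_boundaryMap γ).ae hns] with ζ h2 h3 h4
    refine tendsto_nhds_unique h4 ?_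
    simp_rw [h3]
    exact h2.const_mul _

instance {Γ : Subgroup DiscAut} (σ : Γ →* Circle) : CompleteSpace (HardyChar 2 σ) :=
  (isClosed_hardyChar σ).isComplete.completeSpace_coe

/-- Evaluation of the elements of `L^2` at the points of the disc. -/
def valueCLM : Lp ℂ 2 circleMeasure →L[ℂ] (𝔻 → ℂ) :=
  ContinuousLinearMap.pi fun z => pairing ⟨_, continuous_conj_szego z⟩

theorem valueCLM_apply (f : Lp ℂ 2 circleMeasure) (z : 𝔻) : valueCLM f z = valueAt z f :=
  pairing_apply _ f

theorem eq_zero_of_fourier {f : Lp ℂ 2 circleMeasure}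
    (h : ∀ n : ℤ, ∫ ζ, f ζ * ((ζ ^ n : Circle) : ℂ) ∂circleMeasure = 0) : f = 0 := by
  have hmp : MeasurePreserving (AddCircle.toCircle (T := 2 * π)) AddCircle.haarAddCircle
    circleMeasure := ⟨measurable_toCircle, rfl⟩
  have hg : MemLp (f ∘ AddCircle.toCircle (T := 2 * π)) 2 AddCircle.haarAddCircle :=
    (Lp.memLp f).comp_measurePreserving hmp
  have h0 : hg.toLp = 0 := by
    apply (fourierBasis (T := 2 * π)).repr.injective
    ext n
    rw [fourierBasis_repr, map_zero, lp.coeFn_zero, Pi.zero_apply,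
      fourierCoeff_congr_ae hg.coeFn_toLp, fourierCoeff]
    have hc : Continuous fun ζ : Circle => ((ζ ^ (-n) : Circle) : ℂ) :=
      continuous_coeCircle.comp (continuous_zpow _)
    have e := integral_map (μ := AddCircle.haarAddCircle (T := 2 * π))
      measurable_toCircle.aemeasurable (integrable_mul_of_continuous f hc).aestronglyMeasurable
    refine Eq.trans ?_ (e.symm.trans (h (-n)))
    refine integral_congr_ae (Filter.Eventually.of_forall fun t => ?_)
    simp only [fourier_apply, smul_eq_mul, Function.comp, AddCircle.toCircle_zsmul]
    exact mul_comm _ _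
  have h1 : f ∘ AddCircle.toCircle (T := 2 * π) =ᵐ[AddCircle.haarAddCircle] 0 :=
    hg.coeFn_toLp.symm.trans (by rw [h0]; exact Lp.coeFn_zero _ _ _)
  refine Lp.ext (Filter.EventuallyEq.trans ?_ (Lp.coeFn_zero _ _ _).symm)
  have h2 : MeasurableSet {ζ : Circle | f ζ = (0 : Circle → ℂ) ζ} :=
    measurableSet_eq_fun (Lp.stronglyMeasurable f).measurable measurable_const
  exact (ae_map_iff measurable_toCircle.aemeasurable h2).2 h1

theorem valueAt_hasSum (f : Lp ℂ 2 circleMeasure) (z : 𝔻) :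
    HasSum (fun n : ℕ => (z : ℂ) ^ n * ∫ ζ, f ζ * ((ζ ^ (-(n : ℤ)) : Circle) : ℂ) ∂circleMeasure)
      (valueAt z f) := by
  have hc : ∀ n : ℤ, Continuous fun ζ : Circle => ((ζ ^ n : Circle) : ℂ) := fun n =>
    continuous_coeCircle.comp (continuous_zpow _)
  have hf : Integrable f circleMeasure := (Lp.memLp f).integrable (by norm_num)
  let F : ℕ → Circle → ℂ := fun n ζ => f ζ * ((z : ℂ) ^ n * ((ζ ^ (-(n : ℤ)) : Circle) : ℂ))
  have hF : ∀ n, Integrable (F n) circleMeasure := fun n =>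
    integrable_mul_of_continuous f (continuous_const.mul (hc _))
  have hnorm : ∀ n, ∫ ζ, ‖F n ζ‖ ∂circleMeasure
      = ‖(z : ℂ)‖ ^ n * ∫ ζ, ‖f ζ‖ ∂circleMeasure := fun n => by
    rw [← integral_const_mul]
    refine integral_congr_ae (Filter.Eventually.of_forall fun ζ => ?_)
    simp only [F, norm_mul, norm_pow, Circle.norm_coe, mul_one]
    exact mul_comm _ _
  have hs : Summable fun n => ∫ ζ, ‖F n ζ‖ ∂circleMeasure := by
    simp_rw [hnorm]
    exact (summable_geometric_of_lt_one (norm_nonneg _) z.norm_lt_one).mul_right _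
  have key := hasSum_integral_of_summable_integral_norm hF hs
  have e1 : ∀ n, ∫ ζ, F n ζ ∂circleMeasure
      = (z : ℂ) ^ n * ∫ ζ, f ζ * ((ζ ^ (-(n : ℤ)) : Circle) : ℂ) ∂circleMeasure := fun n => by
    rw [← integral_const_mul]
    refine integral_congr_ae (Filter.Eventually.of_forall fun ζ => ?_)
    simp only [F]; ring
  have e2 : ∀ ζ, ∑' n, F n ζ = f ζ * conj (szego z ζ) := fun ζ => by
    simp only [F]
    rw [tsum_mul_left]
    congr 1
    have hq : ‖(z : ℂ) * ((ζ⁻¹ : Circle) : ℂ)‖ < 1 := by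
      simpa only [norm_mul, Circle.norm_coe, mul_one] using z.norm_lt_one
    have : ∀ n : ℕ, (z : ℂ) ^ n * ((ζ ^ (-(n : ℤ)) : Circle) : ℂ)
        = ((z : ℂ) * ((ζ⁻¹ : Circle) : ℂ)) ^ n := fun n => by
      rw [mul_pow, zpow_neg, zpow_natCast, ← inv_pow, Circle.coe_pow]
    simp_rw [this]
    rw [tsum_geometric_of_norm_lt_one hq, szego, map_inv₀]
    rw [Circle.coe_inv_eq_conj]
    simp
  simp_rw [e1, e2] at key
  exact key

theorem valueCLM_injOn {f : Lp ℂ 2 circleMeasure} (hf : f ∈ Hardy 2) (h : valueCLM f = 0) :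
    f = 0 := by
  let c : ℕ → ℂ := fun n => ∫ ζ, f ζ * ((ζ ^ (-(n : ℤ)) : Circle) : ℂ) ∂circleMeasure
  have hsum : ∀ z : ℂ, ‖z‖ < 1 → HasSum (fun n => z ^ n * c n) 0 := fun z hz => by
    have h1 := valueAt_hasSum f (UnitDisc.mk z hz)
    rw [← valueCLM_apply, h] at h1
    exact h1
  have hps : HasFPowerSeriesAt (0 : ℂ → ℂ) (FormalMultilinearSeries.ofScalars ℂ c) 0 := by
    rw [hasFPowerSeriesAt_iff]
    filter_upwards [ball_mem_nhds (0 : ℂ) one_pos] with z hz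
    simpa [FormalMultilinearSeries.coeff_ofScalars] using hsum z (by simpa using hz)
  have hc : ∀ n, c n = 0 := fun n => by
    have := congrArg (fun p => p.coeff n) hps.eq_zero
    rw [FormalMultilinearSeries.coeff_ofScalars] at this
    exact this.trans rfl
  refine eq_zero_of_fourier fun n => ?_
  rcases lt_or_ge 0 n with hn | hn
  · obtain ⟨k, rfl⟩ := Int.eq_ofNat_of_zero_le hn.le
    have := hf k (by simpa using hn)
    simpa using this
  · obtain ⟨k, hk⟩ := Int.eq_ofNat_of_zero_le (neg_nonneg.2 hn)
    have := hc k
    simp only [c] at this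
    rwa [← hk, neg_neg] at this

theorem hardyChar_ext {Γ : Subgroup DiscAut} (σ : Γ →* Circle) :
    Function.Injective (valueCLM ∘L (HardyChar 2 σ).subtypeL) := by
  refine (injective_iff_map_eq_zero _).2 fun f hf => ?_
  exact Subtype.ext (valueCLM_injOn f.2.1 hf)

instance {Γ : Subgroup DiscAut} (σ : Γ →* Circle) : RKHS ℂ (HardyChar 2 σ) 𝔻 ℂ where
  coeCLM := valueCLM ∘L (HardyChar 2 σ).subtypeL
  coeCLM_injective := hardyChar_ext σ

/-- The reproducing kernel `K^σ(z, w) = k_w^σ(z)` of `H^2_σ`. -/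
def kernelChar {Γ : Subgroup DiscAut} (σ : Γ →* Circle) (z w : 𝔻) : ℂ :=
  RKHS.kernel (HardyChar 2 σ) z w 1

/-! ### Admissible groups -/

/-- The sub-σ-algebra of the `E` with `m(E ∆ γ⁻¹(E)) = 0` for all `γ ∈ Γ`. -/
@[reducible]
def invariantSets (Γ : Subgroup DiscAut) : MeasurableSpace Circle where
  MeasurableSet' E := MeasurableSet E ∧
    ∀ γ ∈ Γ, circleMeasure (symmDiff E (boundaryMap γ ⁻¹' E)) = 0
  measurableSet_empty := ⟨MeasurableSet.empty, fun γ _ => by simp⟩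
  measurableSet_compl := fun E hE => ⟨hE.1.compl, fun γ hγ => by
    rw [preimage_compl, compl_symmDiff_compl]; exact hE.2 γ hγ⟩
  measurableSet_iUnion := fun E hE => ⟨MeasurableSet.iUnion fun i => (hE i).1, fun γ hγ => by
    rw [preimage_iUnion]
    refine measure_mono_null ?_ (measure_iUnion_null fun i => (hE i).2 γ hγ)
    exact iUnion_symmDiff_iUnion_subset ..⟩

theorem invariantSets_le (Γ : Subgroup DiscAut) :
    invariantSets Γ ≤ (inferInstance : MeasurableSpace Circle) := fun _ hE => hE.1

/-- The function `v_γ = Ψ(-i (k_{γ(0)} - conj k_{γ(0)}))`, where `Ψ` is the conditional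
expectation onto the `Γ`-invariant functions. -/
def defectVector (Γ : Subgroup DiscAut) (γ : DiscAut) : Circle →ₘ[circleMeasure] ℂ :=
  AEEqFun.mk
    (circleMeasure[fun ζ => -I * (szego ((γ : Equiv.Perm 𝔻) 0) ζ
      - conj (szego ((γ : Equiv.Perm 𝔻) 0) ζ)) | invariantSets Γ])
    (stronglyMeasurable_condExp.mono (invariantSets_le Γ)).aestronglyMeasurable

/-- The defect space `N = span {v_γ : γ ∈ Γ}`. -/
def defectSpace (Γ : Subgroup DiscAut) : Submodule ℂ (Circle →ₘ[circleMeasure] ℂ) :=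
  Submodule.span ℂ {v | ∃ γ ∈ Γ, v = defectVector Γ γ}

/-- A group of automorphisms is of convergence type if `∑_{γ ∈ Γ} (1 - |γ(0)|) < ∞`. -/
def ConvergenceType (Γ : Subgroup DiscAut) : Prop :=
  Summable fun γ : Γ => 1 - ‖((((γ : DiscAut) : Equiv.Perm 𝔻) 0 : 𝔻) : ℂ)‖

/-- Admissible groups: convergence type and finite-dimensional defect space. -/
def Admissible (Γ : Subgroup DiscAut) : Prop :=
  ConvergenceType Γ ∧ FiniteDimensional ℂ (defectSpace Γ)

end FuchsianHardy

end

open scoped ENNReal ComplexConjugate ComplexOrder Complex.UnitDisc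

noncomputable section

open MeasureTheory Complex Metric Set Filter Topology
open scoped ENNReal ComplexConjugate UnitDisc Real InnerProductSpace

namespace FuchsianHardy

attribute [local instance] two_pi_pos_fact

variable {Γ : Subgroup DiscAut}

/-! ### Integrals over the circle -/

/-! Positivity of the Pick matrix for `σ` says that `k_{z_j} ↦ conj w_j · k_{z_j}` is a contraction
on the span of the kernel functions of `H²_σ` (`posSemidef_pick_iff`). If an interpolating `f`
exists, this map is a restriction of the adjoint of multiplication by `f`, which is a contraction of
`H²_σ` because `f` is invariant (`norm_sum_kernelFun_le_of_interpolation`).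

The converse is a duality argument. An invariant interpolant of norm at most one amounts to a
functional of norm at most one for the `L¹` norm that kills the invariant `L²` functions orthogonal
to `H²_Γ` and sends the kernel function at `z_j` to `conj w_j`. By Hahn-Banach it suffices to show
`|∑ c_j conj w_j| ≤ ‖v‖₁` whenever `v` is invariant and pairs with `H²_Γ` like `∑ c_j k_{z_j}`
(`norm_sum_le_integral`).

For this bound, write `v = k · conj h` with `h` outer and `|h|²` close to `|v|`. Since `|h|` is
invariant, `h` is automorphic for some character `σ` (`exists_outer`). Division by `h` maps `H²_σ`
into `H²_Γ`, so `k` projects in `H²_σ` to a combination `q` of kernel functions. The Pick condition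
for this `σ`, applied to `q` and paired with `h`, gives `|∑ c_j conj w_j| ≤ ‖h‖ ‖k‖`, which tends to
`‖v‖₁`. All characters are needed because the character of `h` depends on `v`.

The outer function is `exp S`, where `S` is a limit of polynomials whose real parts are bounded and
converge to `log |h|`. The quotient `exp (S ∘ γ - S)` is unimodular, and both it and its inverse lie
in `H²`, so it is constant; these constants form the character. -/

theorem integral_circleMeasure {g : Circle → ℂ} (hg : AEStronglyMeasurable g circleMeasure) :
    ∫ ζ, g ζ ∂circleMeasure = (2 * π)⁻¹ • ∫ t in 0..2 * π, g (Circle.exp t) := by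
  rw [circleMeasure, integral_map measurable_toCircle.aemeasurable hg]
  have h1 := AddCircle.intervalIntegral_preimage (2 * π) 0
    (fun t : AddCircle (2 * π) => g (AddCircle.toCircle t))
  rw [zero_add] at h1
  have h2 : ∀ x : ℝ, AddCircle.toCircle (x : AddCircle (2 * π)) = Circle.exp x := fun x => by
    rw [AddCircle.toCircle_apply_mk]
    congr 1
    field_simp
  simp_rw [h2] at h1
  rw [h1, AddCircle.volume_eq_smul_haarAddCircle, integral_smul_measure,
    ENNReal.toReal_ofReal Real.two_pi_pos.le, smul_smul, inv_mul_cancel₀ Real.two_pi_pos.ne',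
    one_smul]

theorem continuous_on_circle {F : ℂ → ℂ} (hF : DiffContOnCl ℂ F (ball 0 1)) :
    Continuous fun ζ : Circle => F ζ := by
  have h := hF.continuousOn_ball
  exact h.comp_continuous continuous_coeCircle fun ζ =>
    mem_closedBall_zero_iff.2 (Circle.norm_coe ζ).le

/-- The mean value property. -/
theorem integral_circle_eq {F : ℂ → ℂ} (hF : DiffContOnCl ℂ F (ball 0 1)) :
    ∫ ζ : Circle, F ζ ∂circleMeasure = F 0 := by
  rw [integral_circleMeasure (continuous_on_circle hF).aestronglyMeasurable]
  have h := DiffContOnCl.circleAverage (f := F) (c := 0) (R := 1) (by simpa using hF)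
  rw [← h, Real.circleAverage_def]
  simp [circleMap]

theorem integral_circle_mul_pow {F : ℂ → ℂ} (hF : DiffContOnCl ℂ F (ball 0 1)) {n : ℕ}
    (hn : 0 < n) : ∫ ζ : Circle, F ζ * (ζ : ℂ) ^ n ∂circleMeasure = 0 := by
  have h : DiffContOnCl ℂ (fun z => F z * z ^ n) (ball 0 1) :=
    hF.smul (Differentiable.diffContOnCl (by fun_prop))
  rw [integral_circle_eq h]
  simp [hn.ne']

theorem memLp_of_continuous {g : Circle → ℂ} (hg : Continuous g) (p : ℝ≥0∞) :
    MemLp g p circleMeasure := by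
  obtain ⟨C, hC⟩ := isCompact_univ.exists_bound_of_continuousOn hg.continuousOn
  exact MemLp.of_bound hg.aestronglyMeasurable C (.of_forall fun x => hC x (mem_univ x))

/-! ### Functions representing the elements of the Hardy space -/

/-- Square integrable functions whose Fourier coefficients of negative index vanish. -/
def IsHardy (f : Circle → ℂ) : Prop :=
  MemLp f 2 circleMeasure ∧ ∀ n : ℕ, 0 < n → ∫ ζ, f ζ * (ζ : ℂ) ^ n ∂circleMeasure = 0

theorem IsHardy.congr {f g : Circle → ℂ} (hf : IsHardy f) (h : f =ᵐ[circleMeasure] g) :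
    IsHardy g := by
  refine ⟨(memLp_congr_ae h).1 hf.1, fun n hn => ?_⟩
  rw [← hf.2 n hn]
  exact integral_congr_ae (by filter_upwards [h] with ζ h; rw [h])

theorem isHardy_coe {f : Lp ℂ 2 circleMeasure} (hf : f ∈ Hardy 2) : IsHardy f :=
  ⟨Lp.memLp f, hf⟩

theorem IsHardy.toLp_mem {f : Circle → ℂ} (hf : IsHardy f) : hf.1.toLp f ∈ Hardy 2 :=
  (hf.congr hf.1.coeFn_toLp.symm).2

theorem isHardy_coe_infty {f : Lp ℂ ∞ circleMeasure} (hf : f ∈ Hardy ∞) : IsHardy f :=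
  ⟨(Lp.memLp f).mono_exponent le_top, hf⟩

theorem isHardy_of_diffContOnCl {F : ℂ → ℂ} (hF : DiffContOnCl ℂ F (ball 0 1)) :
    IsHardy fun ζ => F ζ :=
  ⟨memLp_of_continuous (continuous_on_circle hF) 2, fun _ hn => integral_circle_mul_pow hF hn⟩

/-- Bounded almost everywhere limits of functions in the disc algebra belong to `H²`. -/
theorem isHardy_of_tendsto {F : ℕ → ℂ → ℂ} (hF : ∀ k, DiffContOnCl ℂ (F k) (ball 0 1)) {C : ℝ}
    (hC : ∀ k (ζ : Circle), ‖F k ζ‖ ≤ C) {f : Circle → ℂ}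
    (h : ∀ᵐ ζ : Circle ∂circleMeasure, Tendsto (fun k => F k ζ) atTop (𝓝 (f ζ))) : IsHardy f := by
  have hm : AEStronglyMeasurable f circleMeasure :=
    aestronglyMeasurable_of_tendsto_ae _
      (fun k => (continuous_on_circle (hF k)).aestronglyMeasurable) h
  refine ⟨MemLp.of_bound hm C ?_, fun n hn => ?_⟩
  · filter_upwards [h] with ζ h
    exact le_of_tendsto h.norm (.of_forall fun k => hC k ζ)
  · have key := tendsto_integral_of_dominated_convergence (μ := circleMeasure)
      (F := fun k ζ => F k ζ * (ζ : ℂ) ^ n) (f := fun ζ => f ζ * (ζ : ℂ) ^ n) (fun _ => C)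
      (fun k => ((continuous_on_circle (hF k)).mul (continuous_monomial n)).aestronglyMeasurable)
      (integrable_const C)
      (fun k => .of_forall fun ζ => by
        rw [norm_mul, norm_pow, Circle.norm_coe, one_pow, mul_one]; exact hC k ζ)
      (by filter_upwards [h] with ζ h using h.mul_const _)
    simp_rw [integral_circle_mul_pow (hF _) hn] at key
    exact (tendsto_nhds_unique tendsto_const_nhds key).symm

theorem valueAt_congr {f g : Circle → ℂ} (h : f =ᵐ[circleMeasure] g) (z : 𝔻) :
    valueAt z f = valueAt z g :=
  integral_congr_ae (by filter_upwards [h] with ζ h; rw [h])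

/-! ### Density of the polynomials, and products -/

/-- The monomial `ζ ^ n` in `L²`. -/
def monomialLp (n : ℕ) : Lp ℂ 2 circleMeasure :=
  (memLp_of_continuous (continuous_monomial n) 2).toLp

theorem coeFn_monomialLp (n : ℕ) : monomialLp n =ᵐ[circleMeasure] fun ζ => (ζ : ℂ) ^ n :=
  MemLp.coeFn_toLp _

theorem monomialLp_mem (n : ℕ) : monomialLp n ∈ Hardy 2 :=
  IsHardy.toLp_mem (isHardy_of_diffContOnCl (F := fun z => z ^ n)
    (Differentiable.diffContOnCl (by fun_prop)))

theorem isClosed_hardy : IsClosed (Hardy 2 : Set (Lp ℂ 2 circleMeasure)) := by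
  have : (Hardy 2 : Set (Lp ℂ 2 circleMeasure))
      = ⋂ n : ℕ, ⋂ _ : 0 < n, {f | pairing ⟨_, continuous_monomial n⟩ f = 0} := by
    ext f
    simp only [mem_iInter, mem_ofPred_eq, pairing_apply]
    rfl
  rw [this]
  exact isClosed_iInter fun n => isClosed_iInter fun _ =>
    isClosed_eq (pairing _).continuous continuous_const

/-- A Hardy function orthogonal to all monomials has no Fourier coefficient left, of either sign. -/
theorem hardy_eq_closure :
    Hardy 2 = (Submodule.span ℂ (range monomialLp)).topologicalClosure := by
  set K := (Submodule.span ℂ (range monomialLp)).topologicalClosure with hK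
  have hKH : K ≤ Hardy 2 := Submodule.topologicalClosure_minimal _
    (Submodule.span_le.2 (range_subset_iff.2 monomialLp_mem)) isClosed_hardy
  have : CompleteSpace K := (Submodule.isClosed_topologicalClosure _).isComplete.completeSpace_coe
  refine le_antisymm (fun f hf => ?_) hKH
  suffices f - K.starProjection f = 0 by
    rw [sub_eq_zero.1 this]
    exact K.starProjection_apply_mem f
  have h1 : f - K.starProjection f ∈ Hardy 2 := sub_mem hf (hKH (K.starProjection_apply_mem f))
  have h2 : f - K.starProjection f ∈ Kᗮ := K.sub_starProjection_mem_orthogonal f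
  generalize f - K.starProjection f = g at h1 h2
  refine eq_zero_of_fourier fun n => ?_
  rcases lt_or_ge 0 n with hn | hn
  · obtain ⟨k, rfl⟩ := Int.eq_ofNat_of_zero_le hn.le
    simpa using h1 k (by simpa using hn)
  · obtain ⟨k, hk⟩ := Int.eq_ofNat_of_zero_le (neg_nonneg.2 hn)
    obtain rfl : n = -(k : ℤ) := by omega
    have h3 := h2 (monomialLp k) (Submodule.le_topologicalClosure _
      (Submodule.subset_span (mem_range_self k)))
    rw [L2.inner_def] at h3
    rw [← h3]
    refine integral_congr_ae ?_
    filter_upwards [coeFn_monomialLp k] with ζ h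
    rw [h, zpow_neg, Circle.coe_inv_eq_conj]
    simp

theorem eq_of_eq_on_monomials {ℓ ℓ' : Lp ℂ 2 circleMeasure →L[ℂ] ℂ}
    (h : ∀ n, ℓ (monomialLp n) = ℓ' (monomialLp n)) {f : Lp ℂ 2 circleMeasure}
    (hf : f ∈ Hardy 2) : ℓ f = ℓ' f := by
  rw [hardy_eq_closure] at hf
  have h1 : Submodule.span ℂ (range monomialLp) ≤ (ℓ - ℓ').ker :=
    Submodule.span_le.2 (range_subset_iff.2 fun n => by simp [h n])
  have h2 := Submodule.topologicalClosure_minimal _ h1 (ℓ - ℓ').isClosed_ker hf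
  simpa [sub_eq_zero] using h2

theorem valueAt_pow (z : 𝔻) (m : ℕ) : valueAt z (fun ζ => (ζ : ℂ) ^ m) = (z : ℂ) ^ m := by
  rw [← valueAt_congr (coeFn_monomialLp m) z]
  have h := valueAt_hasSum (monomialLp m) z
  refine h.unique ?_
  have h1 : ∀ n : ℕ, ∫ ζ, monomialLp m ζ * ((ζ ^ (-(n : ℤ)) : Circle) : ℂ) ∂circleMeasure
      = if n = m then 1 else 0 := fun n => by
    rw [integral_congr_ae (g := fun ζ : Circle => ((ζ ^ ((m : ℤ) - n) : Circle) : ℂ)) (by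
      filter_upwards [coeFn_monomialLp m] with ζ h
      rw [h, sub_eq_add_neg, zpow_add]
      simp)]
    split_ifs with hnm
    · simp [hnm]
    · have hi : ∀ k : ℕ, 0 < k → ∫ ζ : Circle, (ζ : ℂ) ^ k ∂circleMeasure = 0 := fun k hk => by
        simpa using integral_circle_mul_pow (F := fun _ => 1) diffContOnCl_const hk
      rcases lt_or_gt_of_ne hnm with hlt | hlt
      · have e : (m : ℤ) - n = ((m - n : ℕ) : ℤ) := by omega
        simp_rw [e, zpow_natCast, Circle.coe_pow]
        exact hi _ (by omega)
      · have e : (m : ℤ) - n = -((n - m : ℕ) : ℤ) := by omega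
        simp_rw [e, zpow_neg, zpow_natCast, Circle.coe_inv_eq_conj, Circle.coe_pow]
        rw [integral_conj, hi _ (by omega), map_zero]
  convert hasSum_ite_eq m ((z : ℂ) ^ m) using 2 with n
  rw [h1]
  split_ifs with hnm <;> simp [hnm]

/-- The bilinear form `∫ f g dm` on `L²`. -/
def mulPairing : Lp ℂ 2 circleMeasure →L[ℂ] Lp ℂ 2 circleMeasure →L[ℂ] ℂ :=
  (ContinuousLinearMap.mul ℂ ℂ).lpPairing circleMeasure 2 2

theorem mulPairing_toLp {f g : Circle → ℂ} (hf : MemLp f 2 circleMeasure)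
    (hg : MemLp g 2 circleMeasure) :
    mulPairing (hf.toLp f) (hg.toLp g) = ∫ ζ, f ζ * g ζ ∂circleMeasure := by
  rw [mulPairing, ContinuousLinearMap.lpPairing_eq_integral]
  refine integral_congr_ae ?_
  filter_upwards [hf.coeFn_toLp, hg.coeFn_toLp] with ζ h1 h2
  rw [h1, h2]
  rfl

theorem memLp_mul_continuous {f g : Circle → ℂ} (hf : MemLp f 2 circleMeasure)
    (hg : Continuous g) : MemLp (fun ζ => f ζ * g ζ) 2 circleMeasure :=
  MemLp.mul' (memLp_of_continuous hg ∞) hf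

/-- Both sides are bilinear and separately continuous in `L²`, so density of the polynomials is
applied to one variable at a time. With `φ = φ' = 0` this gives the vanishing of the negative
coefficients of a product, with evaluations the multiplicativity of point values; the product itself
need only be in `L¹`. -/
theorem eq_mul_of_eq_on_monomials {g : Circle → ℂ} (hg : Continuous g)
    (φ φ' : Lp ℂ 2 circleMeasure →L[ℂ] ℂ)
    (h : ∀ a b : ℕ, ∫ ζ : Circle, (ζ : ℂ) ^ a * ((ζ : ℂ) ^ b * g ζ) ∂circleMeasure
      = φ (monomialLp a) * φ' (monomialLp b))
    {f₁ f₂ : Circle → ℂ} (h₁ : IsHardy f₁) (h₂ : IsHardy f₂) :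
    ∫ ζ, f₁ ζ * (f₂ ζ * g ζ) ∂circleMeasure = φ (h₁.1.toLp f₁) * φ' (h₂.1.toLp f₂) := by
  have hm : ∀ a, MemLp (fun ζ : Circle => (ζ : ℂ) ^ a) 2 circleMeasure := fun a =>
    memLp_of_continuous (continuous_monomial a) 2
  have hfg := memLp_mul_continuous h₂.1 hg
  rw [← mulPairing_toLp h₁.1 hfg]
  refine eq_of_eq_on_monomials (ℓ := mulPairing.flip (hfg.toLp _))
    (ℓ' := φ' (h₂.1.toLp f₂) • φ) (fun a => ?_) h₁.toLp_mem |>.trans ?_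
  · have hga := memLp_mul_continuous (hm a) hg
    rw [ContinuousLinearMap.flip_apply, monomialLp, mulPairing_toLp]
    have e : ∫ ζ : Circle, (ζ : ℂ) ^ a * (f₂ ζ * g ζ) ∂circleMeasure
        = mulPairing.flip (hga.toLp _) (h₂.1.toLp f₂) := by
      rw [ContinuousLinearMap.flip_apply, mulPairing_toLp]
      exact integral_congr_ae (.of_forall fun ζ => by ring)
    rw [e]
    refine eq_of_eq_on_monomials (ℓ' := φ (monomialLp a) • φ') (fun b => ?_) h₂.toLp_mem |>.trans ?_
    · refine Eq.trans ?_ (h a b)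
      rw [ContinuousLinearMap.flip_apply, monomialLp, mulPairing_toLp]
      exact integral_congr_ae (.of_forall fun ζ => by ring)
    · simp [mul_comm, monomialLp]
  · simp [mul_comm]

theorem IsHardy.integral_mul_pow {f₁ f₂ : Circle → ℂ} (h₁ : IsHardy f₁) (h₂ : IsHardy f₂) {n : ℕ}
    (hn : 0 < n) : ∫ ζ, f₁ ζ * f₂ ζ * (ζ : ℂ) ^ n ∂circleMeasure = 0 := by
  simp_rw [mul_assoc]
  rw [eq_mul_of_eq_on_monomials (continuous_monomial n) 0 0 (fun a b => ?_) h₁ h₂]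
  · simp
  · have := integral_circle_mul_pow (F := fun z => z ^ a * z ^ b)
      (Differentiable.diffContOnCl (by fun_prop)) hn
    simpa [mul_assoc] using this

theorem IsHardy.valueAt_mul {f₁ f₂ : Circle → ℂ} (h₁ : IsHardy f₁) (h₂ : IsHardy f₂) (z : 𝔻) :
    valueAt z (fun ζ => f₁ ζ * f₂ ζ) = valueAt z f₁ * valueAt z f₂ := by
  let φ : Lp ℂ 2 circleMeasure →L[ℂ] ℂ := pairing ⟨_, continuous_conj_szego z⟩
  have hφ : ∀ f, φ f = valueAt z f := fun f => pairing_apply _ f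
  rw [← valueAt_congr h₁.1.coeFn_toLp z, ← valueAt_congr h₂.1.coeFn_toLp z, ← hφ, ← hφ,
    ← eq_mul_of_eq_on_monomials (continuous_conj_szego z) φ φ (fun a b => ?_) h₁ h₂]
  · simp_rw [valueAt, mul_assoc]
  · rw [hφ, hφ, valueAt_congr (coeFn_monomialLp a), valueAt_congr (coeFn_monomialLp b),
      valueAt_pow, valueAt_pow, ← pow_add, ← valueAt_pow]
    simp_rw [valueAt, pow_add, mul_assoc]

theorem IsHardy.mul {f₁ f₂ : Circle → ℂ} (h₁ : IsHardy f₁) (h₂ : IsHardy f₂)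
    (h : MemLp (fun ζ => f₁ ζ * f₂ ζ) 2 circleMeasure) : IsHardy fun ζ => f₁ ζ * f₂ ζ :=
  ⟨h, fun _ hn => h₁.integral_mul_pow h₂ hn⟩

theorem isHardy_const (c : ℂ) : IsHardy fun _ => c :=
  isHardy_of_diffContOnCl (F := fun _ => c) diffContOnCl_const

theorem valueAt_const (z : 𝔻) (c : ℂ) : valueAt z (fun _ => c) = c := by
  have h := valueAt_pow z 0
  simp only [valueAt, pow_zero, one_mul] at h
  simp [valueAt, integral_const_mul, h]

/-- A function of `H²` whose conjugate is in `H²` is constant. -/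
theorem IsHardy.eq_const {f : Circle → ℂ} (h : IsHardy f) (h' : IsHardy fun ζ => conj (f ζ)) :
    ∃ c : ℂ, f =ᵐ[circleMeasure] fun _ => c := by
  refine ⟨∫ ζ, f ζ ∂circleMeasure, ?_⟩
  set c := ∫ ζ, f ζ ∂circleMeasure with hc
  have hm : MemLp (fun ζ => f ζ - c) 2 circleMeasure := h.1.sub (memLp_const c)
  have hi : Integrable f circleMeasure := h.1.integrable (by norm_num)
  suffices h0 : hm.toLp = 0 by
    have h1 := hm.coeFn_toLp
    rw [h0] at h1
    filter_upwards [h1, Lp.coeFn_zero ℂ 2 circleMeasure] with ζ h2 h3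
    rw [h3] at h2
    exact sub_eq_zero.1 h2.symm
  refine eq_zero_of_fourier fun n => ?_
  rw [integral_congr_ae (g := fun ζ => f ζ * ((ζ ^ n : Circle) : ℂ) - c * ((ζ ^ n : Circle) : ℂ)) (by
    filter_upwards [hm.coeFn_toLp] with ζ h
    rw [h]; ring)]
  have hcn : Continuous fun ζ : Circle => ((ζ ^ n : Circle) : ℂ) :=
    continuous_coeCircle.comp (continuous_zpow _)
  have hI : Integrable (fun ζ : Circle => f ζ * ((ζ ^ n : Circle) : ℂ)) circleMeasure :=
    (memLp_mul_continuous h.1 hcn).integrable (by norm_num)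
  have hI' : Integrable (fun ζ : Circle => c * ((ζ ^ n : Circle) : ℂ)) circleMeasure :=
    ((memLp_of_continuous hcn 1).integrable le_rfl).const_mul c
  rw [integral_sub hI hI']
  -- The hypothesis on the conjugate removes the coefficients on the other side; the remaining one,
  -- at `n = 0`, is cancelled by the choice of `c`.
  have hneg : ∀ (F : Circle → ℂ), (IsHardy fun ζ => conj (F ζ)) → ∀ k : ℕ, 0 < k →
      ∫ ζ, F ζ * ((ζ ^ (-(k : ℤ)) : Circle) : ℂ) ∂circleMeasure = 0 := fun F hF k hk => by
    have h3 := congrArg conj (hF.2 k hk)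
    rw [← integral_conj, map_zero] at h3
    rw [← h3]
    refine integral_congr_ae (.of_forall fun ζ => ?_)
    simp only [zpow_neg, zpow_natCast, Circle.coe_inv_eq_conj]
    simp
  rcases lt_trichotomy n 0 with hn | rfl | hn
  · obtain ⟨k, hk⟩ := Int.eq_ofNat_of_zero_le (neg_nonneg.2 hn.le)
    obtain rfl : n = -(k : ℤ) := by omega
    rw [hneg f h' k (by omega), hneg (fun _ => c) (isHardy_const _) k (by omega), sub_zero]
  · simp [← hc]
  · obtain ⟨k, rfl⟩ := Int.eq_ofNat_of_zero_le hn.le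
    have h1 := h.2 k (by omega)
    have h2 := (isHardy_const c).2 k (by omega)
    simp only [zpow_natCast, Circle.coe_pow, h1, h2, sub_zero]

/-! ### Outer functions with prescribed modulus -/

open Polynomial in
-- On the circle a negative power is the conjugate of a positive one, and conjugation preserves real
-- parts. The factor `c` is there for the induction: taking real parts does not commute with complex
-- scalars.
theorem exists_polynomial_re_eq {q : C(AddCircle (2 * π), ℂ)}
    (hq : q ∈ Submodule.span ℂ (range (fourier (T := 2 * π)))) (c : ℂ) :
    ∃ p : ℂ[X], ∀ t : AddCircle (2 * π), (p.eval (t.toCircle : ℂ)).re = (c * q t).re := by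
  induction hq using Submodule.span_induction generalizing c with
  | mem q hq =>
    obtain ⟨n, rfl⟩ := hq
    rcases le_total 0 n with hn | hn
    · obtain ⟨k, rfl⟩ := Int.eq_ofNat_of_zero_le hn
      exact ⟨C c * X ^ k, fun t => by simp [fourier_apply, AddCircle.toCircle_nsmul]⟩
    · obtain ⟨k, hk⟩ := Int.eq_ofNat_of_zero_le (neg_nonneg.2 hn)
      obtain rfl : n = -(k : ℤ) := by omega
      refine ⟨C (conj c) * X ^ k, fun t => ?_⟩
      have : (c * fourier (-(k : ℤ)) t) = conj (conj c * (t.toCircle : ℂ) ^ k) := by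
        rw [fourier_neg, fourier_apply]
        simp [AddCircle.toCircle_nsmul]
      rw [this, conj_re]
      simp
  | zero => exact ⟨0, by simp⟩
  | add q q' _ _ h h' =>
    obtain ⟨p, hp⟩ := h c
    obtain ⟨p', hp'⟩ := h' c
    exact ⟨p + p', fun t => by rw [eval_add, add_re, hp, hp', ← add_re]; simp [mul_add]⟩
  | smul a q _ h =>
    obtain ⟨p, hp⟩ := h (c * a)
    exact ⟨p, fun t => by rw [hp]; simp [mul_assoc]⟩

open Polynomial in
theorem exists_polynomial_re_approx {φ : Circle → ℝ} (hφ : Continuous φ) {δ : ℝ} (hδ : 0 < δ) :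
    ∃ p : ℂ[X], (p.eval 0).im = 0 ∧ ∀ ζ : Circle, |(p.eval (ζ : ℂ)).re - φ ζ| ≤ δ := by
  let Φ : C(AddCircle (2 * π), ℂ) := ⟨fun t => (φ t.toCircle : ℂ),
    continuous_ofReal.comp (hφ.comp AddCircle.continuous_toCircle)⟩
  have hΦ : Φ ∈ (Submodule.span ℂ (range (fourier (T := 2 * π)))).topologicalClosure := by
    rw [span_fourier_closure_eq_top]; trivial
  obtain ⟨q, hq, hd⟩ := Metric.mem_closure_iff.1 hΦ δ hδ
  obtain ⟨p, hp⟩ := exists_polynomial_re_eq hq 1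
  -- Subtracting an imaginary constant makes the value at `0` real and leaves the real part
  -- unchanged.
  refine ⟨p - C (((p.eval 0).im : ℂ) * I), by simp, fun ζ => ?_⟩
  obtain ⟨t, rfl⟩ : ∃ t : AddCircle (2 * π), t.toCircle = ζ :=
    ⟨_, (AddCircle.homeomorphCircle_apply Real.two_pi_pos.ne' _).symm.trans
      ((AddCircle.homeomorphCircle Real.two_pi_pos.ne').apply_symm_apply ζ)⟩
  have h1 : ‖Φ t - q t‖ ≤ δ := by
    rw [← dist_eq_norm]
    exact (ContinuousMap.dist_apply_le_dist t).trans hd.le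
  have h2 := (abs_re_le_norm (Φ t - q t)).trans h1
  rw [abs_sub_comm]
  simpa [hp, Φ] using h2

open Polynomial in
theorem exists_polynomial_re_approx_sq {u : Circle → ℝ} (hu : Measurable u) {C : ℝ}
    (hC : ∀ ζ, |u ζ| ≤ C) {δ : ℝ} (hδ : 0 < δ) :
    ∃ p : ℂ[X], (p.eval 0).im = 0 ∧ (∀ ζ : Circle, |(p.eval (ζ : ℂ)).re| ≤ C + 1) ∧
      ∫ ζ : Circle, ((p.eval (ζ : ℂ)).re - u ζ) ^ 2 ∂circleMeasure ≤ δ := by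
  have hum : MemLp u (ENNReal.ofReal 2) circleMeasure :=
    MemLp.of_bound hu.aestronglyMeasurable C (.of_forall hC)
  obtain ⟨φ, hφ, -⟩ := hum.exists_boundedContinuous_integral_rpow_sub_le two_pos
    (ε := δ / 4) (by positivity)
  -- Clamping to `[-C, C]` is 1-Lipschitz and fixes `u`, so it bounds the approximant without
  -- increasing its distance to `u`.
  set ψ : Circle → ℝ := fun ζ => max (-C) (min C (φ ζ)) with hψ
  have hψc : Continuous ψ := by fun_prop
  have hC0 : 0 ≤ C := (abs_nonneg _).trans (hC 1)
  have hψC : ∀ ζ, |ψ ζ| ≤ C := fun ζ => abs_le.2 ⟨le_max_left _ _,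
    max_le (by linarith) (min_le_left _ _)⟩
  have hψu : ∀ ζ, |ψ ζ - u ζ| ≤ |u ζ - φ ζ| := fun ζ => by
    have h1 := abs_le.1 (hC ζ)
    have h2 : max (-C) (min C (u ζ)) = u ζ := by rw [min_eq_right h1.2, max_eq_right h1.1]
    calc |ψ ζ - u ζ| = |max (-C) (min C (φ ζ)) - max (-C) (min C (u ζ))| := by rw [h2]
      _ ≤ |min C (φ ζ) - min C (u ζ)| := by
          simpa using abs_max_sub_max_le_max (-C) (min C (φ ζ)) (-C) (min C (u ζ))
      _ ≤ |φ ζ - u ζ| := by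
          simpa using abs_min_sub_min_le_max C (φ ζ) C (u ζ)
      _ = _ := abs_sub_comm _ _
  -- `η ≤ 1` yields the uniform bound `C + 1`; `2 η² ≤ δ / 2` is one half of the `L²` error.
  set η := min 1 (Real.sqrt (δ / 4)) with hη
  have hη0 : 0 < η := lt_min one_pos (Real.sqrt_pos.2 (by positivity))
  have hη2 : η ^ 2 ≤ δ / 4 := by
    calc η ^ 2 ≤ (Real.sqrt (δ / 4)) ^ 2 := by gcongr; exact min_le_right _ _
      _ = δ / 4 := Real.sq_sqrt (by positivity)
  obtain ⟨p, hp0, hp⟩ := exists_polynomial_re_approx hψc hη0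
  refine ⟨p, hp0, fun ζ => ?_, ?_⟩
  · have h1 := hp ζ
    have h2 := hψC ζ
    have h3 : η ≤ 1 := min_le_left _ _
    rw [abs_le] at h1 h2 ⊢
    constructor <;> linarith
  · have hb : ∀ ζ : Circle, ((p.eval (ζ : ℂ)).re - u ζ) ^ 2 ≤ δ / 2 + 2 * ‖u ζ - φ ζ‖ ^ (2 : ℝ) :=
      fun ζ => by
      have h1 := sq_le_sq' (abs_le.1 (hp ζ)).1 (abs_le.1 (hp ζ)).2
      have h2 := sq_le_sq.2 (hψu ζ)
      rw [Real.rpow_two, Real.norm_eq_abs, sq_abs]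
      nlinarith [sq_nonneg ((p.eval (ζ : ℂ)).re - ψ ζ - (ψ ζ - u ζ))]
    have hi : Integrable (fun ζ => ‖u ζ - φ ζ‖ ^ (2 : ℝ)) circleMeasure := by
      have h1 : MemLp (fun ζ => u ζ - φ ζ) (ENNReal.ofReal 2) circleMeasure := hum.sub
        (MemLp.of_bound φ.continuous.aestronglyMeasurable ‖φ‖ (.of_forall φ.norm_coe_le_norm))
      simpa using h1.integrable_norm_rpow (by simp) (by simp)
    calc _ ≤ ∫ ζ, (δ / 2 + 2 * ‖u ζ - φ ζ‖ ^ (2 : ℝ)) ∂circleMeasure :=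
          integral_mono_of_nonneg (.of_forall fun ζ => sq_nonneg _)
            ((integrable_const _).add (hi.const_mul 2)) (.of_forall hb)
      _ = δ / 2 + 2 * ∫ ζ, ‖u ζ - φ ζ‖ ^ (2 : ℝ) ∂circleMeasure := by
          rw [integral_add (integrable_const _) (hi.const_mul 2), integral_const_mul]
          simp
      _ ≤ δ := by linarith

theorem integrable_of_continuous_real {g : Circle → ℝ} (hg : Continuous g) :
    Integrable g circleMeasure := by
  obtain ⟨C, hC⟩ := isCompact_univ.exists_bound_of_continuousOn hg.continuousOn
  exact Integrable.of_bound hg.aestronglyMeasurable C (.of_forall fun x => hC x (mem_univ x))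

open Polynomial in
theorem continuous_eval_circle (p : ℂ[X]) : Continuous fun ζ : Circle => p.eval (ζ : ℂ) :=
  p.continuous.comp continuous_coeCircle

open Polynomial in
-- The `L²` bound for the conjugate function: the mean of `Re (p²) = (Re p)² - (Im p)²` is `Re
-- (p(0)²)`, which is nonnegative when `p(0)` is real.
theorem integral_normSq_le {p : ℂ[X]} (hp : (p.eval 0).im = 0) :
    ∫ ζ : Circle, ‖p.eval (ζ : ℂ)‖ ^ 2 ∂circleMeasure
      ≤ 2 * ∫ ζ : Circle, (p.eval (ζ : ℂ)).re ^ 2 ∂circleMeasure := by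
  have h := integral_circle_eq (F := fun z => p.eval z ^ 2)
    (Differentiable.diffContOnCl (by fun_prop))
  have hc := continuous_eval_circle p
  have hi : Integrable (fun ζ : Circle => p.eval (ζ : ℂ) ^ 2) circleMeasure :=
    (memLp_of_continuous (hc.pow 2) 1).integrable le_rfl
  have h1 := congrArg re h
  have h2 : ∫ ζ : Circle, (p.eval (ζ : ℂ) ^ 2).re ∂circleMeasure = ((p.eval 0) ^ 2).re := by
    rw [← h1]; exact integral_re hi
  have h3 : 0 ≤ ((p.eval 0) ^ 2).re := by
    rw [sq, mul_re, hp]; nlinarith [sq_nonneg (p.eval 0).re]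
  have hir : Integrable (fun ζ : Circle => (p.eval (ζ : ℂ)).re ^ 2) circleMeasure :=
    integrable_of_continuous_real ((continuous_re.comp hc).pow 2)
  have h4 : ∀ ζ : Circle, ‖p.eval (ζ : ℂ)‖ ^ 2
      = 2 * (p.eval (ζ : ℂ)).re ^ 2 - (p.eval (ζ : ℂ) ^ 2).re := fun ζ => by
    rw [← normSq_eq_norm_sq, normSq_apply, sq (p.eval _), mul_re]; ring
  simp_rw [h4]
  have hir' : Integrable (fun ζ : Circle => (p.eval (ζ : ℂ) ^ 2).re) circleMeasure := hi.re
  rw [integral_sub (hir.const_mul 2) hir', integral_const_mul, h2]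
  linarith

theorem norm_toLp_sq {f : Circle → ℂ} (hf : MemLp f 2 circleMeasure) :
    ‖hf.toLp f‖ ^ 2 = ∫ ζ, ‖f ζ‖ ^ 2 ∂circleMeasure := by
  have h : ⟪hf.toLp f, hf.toLp f⟫_ℂ = ((∫ ζ, ‖f ζ‖ ^ 2 ∂circleMeasure : ℝ) : ℂ) := by
    rw [L2.inner_def]
    refine (integral_congr_ae ?_).trans integral_complex_ofReal
    filter_upwards [hf.coeFn_toLp] with ζ h
    rw [h, inner_self_eq_norm_sq_to_K]
    norm_cast
  rw [← inner_self_eq_norm_sq (𝕜 := ℂ), h]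
  simp

open Polynomial in
/-- A bounded real function is the real part of the limit of polynomials with bounded real parts. -/
theorem exists_herglotz {u : Circle → ℝ} (hu : Measurable u) {C : ℝ} (hC : ∀ ζ, |u ζ| ≤ C) :
    ∃ (p : ℕ → ℂ[X]) (S : Circle → ℂ), (∀ k (ζ : Circle), |((p k).eval (ζ : ℂ)).re| ≤ C + 1) ∧
      (∀ᵐ ζ : Circle ∂circleMeasure, Tendsto (fun k => (p k).eval (ζ : ℂ)) atTop (𝓝 (S ζ))) ∧
      ∀ᵐ ζ ∂circleMeasure, (S ζ).re = u ζ := by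
  have hex := fun k : ℕ => exists_polynomial_re_approx_sq hu hC (δ := (1 / 4) ^ k) (by positivity)
  choose p hp0 hpC hpu using hex
  have hm : ∀ k, MemLp (fun ζ : Circle => (p k).eval (ζ : ℂ)) 2 circleMeasure := fun k =>
    memLp_of_continuous (continuous_eval_circle _) 2
  have hiu : ∀ k, Integrable (fun ζ : Circle => (((p k).eval (ζ : ℂ)).re - u ζ) ^ 2)
      circleMeasure := fun k => by
    refine Integrable.of_bound (C := (C + 1 + C) ^ 2) ?_ (.of_forall fun ζ => ?_)
    · exact (((measurable_re.comp (continuous_eval_circle (p k)).measurable).sub hu).pow_const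
        2).aestronglyMeasurable
    · rw [Real.norm_eq_abs, abs_of_nonneg (sq_nonneg _)]
      refine sq_le_sq' ?_ ?_ <;>
        linarith [(abs_le.1 (hpC k ζ)).1, (abs_le.1 (hpC k ζ)).2, (abs_le.1 (hC ζ)).1,
          (abs_le.1 (hC ζ)).2]
  -- The real parts are Cauchy because they approach `u`, and `integral_normSq_le` carries this over
  -- to the full polynomials. The squared distance is at most `5 · 4⁻ᵏ ≤ (3 · 2⁻ᵏ)²`.
  have hcauchy : CauchySeq fun k => (hm k).toLp := by
    refine cauchySeq_of_le_geometric (1 / 2) 3 (by norm_num) fun k => ?_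
    rw [dist_eq_norm, ← MemLp.toLp_sub]
    refine abs_le_of_sq_le_sq' ?_ (by positivity) |>.2
    rw [norm_toLp_sq]
    have h1 := integral_normSq_le (p := p k - p (k + 1)) (by simp [hp0])
    simp only [eval_sub] at h1
    have h2 : ∫ ζ : Circle, ((p k).eval (ζ : ℂ) - (p (k + 1)).eval (ζ : ℂ)).re ^ 2 ∂circleMeasure
        ≤ 2 * (1 / 4) ^ k + 2 * (1 / 4) ^ (k + 1) := by
      calc _ ≤ ∫ ζ : Circle, (2 * (((p k).eval (ζ : ℂ)).re - u ζ) ^ 2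
            + 2 * (((p (k + 1)).eval (ζ : ℂ)).re - u ζ) ^ 2) ∂circleMeasure := by
            refine integral_mono_of_nonneg (.of_forall fun ζ => sq_nonneg _)
              (((hiu k).const_mul 2).add ((hiu (k + 1)).const_mul 2)) (.of_forall fun ζ => ?_)
            simp only [sub_re]
            nlinarith [sq_nonneg (((p k).eval (ζ : ℂ)).re - u ζ
              + (((p (k + 1)).eval (ζ : ℂ)).re - u ζ))]
        _ ≤ _ := by
            rw [integral_add ((hiu k).const_mul 2) ((hiu (k + 1)).const_mul 2),
              integral_const_mul, integral_const_mul]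
            linarith [hpu k, hpu (k + 1)]
    calc _ ≤ _ := h1
      _ ≤ 2 * (2 * (1 / 4) ^ k + 2 * (1 / 4) ^ (k + 1)) := by linarith
      _ ≤ (3 * (1 / 2 : ℝ) ^ k) ^ 2 := by
          have : ((1 / 2 : ℝ) ^ k) ^ 2 = (1 / 4) ^ k := by rw [← pow_mul, mul_comm, pow_mul]; norm_num
          rw [mul_pow, this, pow_succ]
          nlinarith [pow_pos (show (0 : ℝ) < 1 / 4 by norm_num) k]
  obtain ⟨S, hS⟩ := cauchySeq_tendsto_of_complete hcauchy
  obtain ⟨ns, hns, hlim⟩ := (tendstoInMeasure_of_tendsto_Lp hS).exists_seq_tendsto_ae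
  have hlim' : ∀ᵐ ζ : Circle ∂circleMeasure,
      Tendsto (fun k => (p (ns k)).eval (ζ : ℂ)) atTop (𝓝 (S ζ)) := by
    filter_upwards [hlim, ae_all_iff.2 fun k => (hm k).coeFn_toLp] with ζ h1 h2
    simpa only [h2] using h1
  refine ⟨fun k => p (ns k), S, fun k => hpC _, hlim', ?_⟩
  have key := tendsto_integral_of_dominated_convergence (μ := circleMeasure)
    (F := fun k (ζ : Circle) => (((p (ns k)).eval (ζ : ℂ)).re - u ζ) ^ 2)
    (f := fun ζ => ((S ζ).re - u ζ) ^ 2) (fun _ => (C + 1 + C) ^ 2)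
    (fun k => (hiu _).1) (integrable_const _)
    (fun k => .of_forall fun ζ => by
      rw [Real.norm_eq_abs, abs_of_nonneg (sq_nonneg _)]
      refine sq_le_sq' ?_ ?_ <;>
        linarith [(abs_le.1 (hpC (ns k) ζ)).1, (abs_le.1 (hpC (ns k) ζ)).2, (abs_le.1 (hC ζ)).1,
          (abs_le.1 (hC ζ)).2])
    (by
      filter_upwards [hlim'] with ζ h
      exact (((continuous_re.tendsto _).comp h).sub_const _).pow 2)
  have hzero : ∫ ζ, ((S ζ).re - u ζ) ^ 2 ∂circleMeasure = 0 := by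
    refine tendsto_nhds_unique key (squeeze_zero (fun k => integral_nonneg fun ζ => sq_nonneg _)
      (fun k => hpu (ns k)) ?_)
    exact (tendsto_pow_atTop_nhds_zero_of_lt_one (by norm_num) (by norm_num)).comp
      hns.tendsto_atTop
  have hiS : Integrable (fun ζ => ((S ζ).re - u ζ) ^ 2) circleMeasure := by
    have h1 : MemLp (fun ζ => (S ζ).re - u ζ) 2 circleMeasure :=
      (Lp.memLp S).re.sub (MemLp.of_bound hu.aestronglyMeasurable C (.of_forall hC))
    exact h1.integrable_sq
  have := (integral_eq_zero_iff_of_nonneg (fun ζ => sq_nonneg ((S ζ).re - u ζ)) hiS).1 hzero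
  filter_upwards [this] with ζ h
  simpa [sub_eq_zero] using h

/-! ### The action of automorphisms on the closed disc -/

/-- The Möbius transformation extending an automorphism of the disc. -/
def moebius (φ : DiscAut) (z : ℂ) : ℂ :=
  rotation φ * ((center φ - z) / (1 - conj (center φ : ℂ) * z))

theorem moebius_circle (φ : DiscAut) (ζ : Circle) : moebius φ ζ = boundaryMap φ ζ := rfl

theorem moebius_disc (φ : DiscAut) (z : 𝔻) : moebius φ z = ((φ : Equiv.Perm 𝔻) z : 𝔻) :=
  (discAut_apply φ z).symm

theorem differentiableOn_moebius (φ : DiscAut) : DifferentiableOn ℂ (moebius φ) (ball 0 1) :=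
  (diff_blaschke (center φ).norm_lt_one).const_mul _

theorem continuousOn_moebius (φ : DiscAut) : ContinuousOn (moebius φ) (closedBall 0 1) := by
  refine ContinuousOn.mul continuousOn_const (ContinuousOn.div (by fun_prop) (by fun_prop) ?_)
  exact fun z hz => one_sub_ne (center φ).norm_lt_one (mem_closedBall_zero_iff.1 hz)

theorem moebius_mem_closedBall (φ : DiscAut) {z : ℂ} (hz : z ∈ closedBall (0 : ℂ) 1) :
    moebius φ z ∈ closedBall (0 : ℂ) 1 := by
  rw [mem_closedBall_zero_iff] at hz ⊢
  rw [moebius, norm_mul, Circle.norm_coe, one_mul]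
  rcases hz.lt_or_eq with h | h
  · exact (norm_blaschke_lt (center φ).norm_lt_one h).le
  · exact (norm_blaschke_eq (center φ).norm_lt_one h).le

/-- Inside the disc this is composition in the group; continuity extends it to the circle. -/
theorem moebius_mul (φ ψ : DiscAut) {z : ℂ} (hz : z ∈ closedBall (0 : ℂ) 1) :
    moebius (φ * ψ) z = moebius φ (moebius ψ z) := by
  have h1 : EqOn (moebius (φ * ψ)) (fun z => moebius φ (moebius ψ z)) (ball 0 1) := fun z hz => by
    have e := moebius_disc (φ * ψ) (UnitDisc.mk z (by simpa using hz))
    have e' := moebius_disc ψ (UnitDisc.mk z (by simpa using hz))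
    simp only [UnitDisc.coe_mk] at e e'
    simp only [e, e', moebius_disc]
    rfl
  refine h1.of_subset_closure (continuousOn_moebius _)
    ((continuousOn_moebius φ).comp (continuousOn_moebius ψ) fun _ => moebius_mem_closedBall ψ)
    ball_subset_closedBall ?_ hz
  rw [closure_ball _ one_ne_zero]

theorem boundaryMap_mul (φ ψ : DiscAut) (ζ : Circle) :
    boundaryMap (φ * ψ) ζ = boundaryMap φ (boundaryMap ψ ζ) := by
  apply Circle.ext
  rw [← moebius_circle, ← moebius_circle, ← moebius_circle]
  exact moebius_mul φ ψ (mem_closedBall_zero_iff.2 (Circle.norm_coe ζ).le)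

theorem boundaryMap_one (ζ : Circle) : boundaryMap 1 ζ = ζ := by
  apply Circle.ext
  have h1 : EqOn (moebius 1) id (ball 0 1) := fun z hz => by
    exact moebius_disc 1 (UnitDisc.mk z (by simpa using hz))
  exact h1.of_subset_closure (continuousOn_moebius _) continuousOn_id
    ball_subset_closedBall (by rw [closure_ball _ one_ne_zero])
    (mem_closedBall_zero_iff.2 (Circle.norm_coe ζ).le)

theorem diffContOnCl_comp_moebius (φ : DiscAut) {F : ℂ → ℂ} (hF : Differentiable ℂ F) :
    DiffContOnCl ℂ (fun z => F (moebius φ z)) (ball 0 1) := by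
  refine ⟨hF.comp_differentiableOn (differentiableOn_moebius φ), ?_⟩
  rw [closure_ball _ one_ne_zero]
  exact hF.continuous.comp_continuousOn (continuousOn_moebius φ)

/-! ### Automorphic outer functions -/

open Polynomial in
-- Each `exp (p_k ∘ φ)` is in the disc algebra and bounded by `exp C` on the circle. Having `φ` in
-- the approximants means that invariance of `H²` under composition is never needed in general.
theorem isHardy_exp_comp {p : ℕ → ℂ[X]} {C : ℝ}
    (hp : ∀ k (ζ : Circle), ((p k).eval (ζ : ℂ)).re ≤ C) {S : Circle → ℂ}
    (hS : ∀ᵐ ζ : Circle ∂circleMeasure, Tendsto (fun k => (p k).eval (ζ : ℂ)) atTop (𝓝 (S ζ)))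
    (φ : DiscAut) : IsHardy fun ζ => exp (S (boundaryMap φ ζ)) := by
  refine isHardy_of_tendsto (F := fun k z => exp ((p k).eval (moebius φ z))) (C := Real.exp C)
    (fun k => diffContOnCl_comp_moebius φ (F := fun z => exp ((p k).eval z)) (by fun_prop))
    (fun k ζ => ?_) ?_
  · rw [moebius_circle, norm_exp]
    exact Real.exp_le_exp.2 (hp k _)
  · filter_upwards [(quasiMeasurePreserving_boundaryMap φ).ae hS] with ζ h
    simp only [moebius_circle]
    exact (continuous_exp.tendsto _).comp h

theorem memLp_mul_of_bound {f g : Circle → ℂ} {C : ℝ} (hf : MemLp f 2 circleMeasure)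
    (hg : AEStronglyMeasurable g circleMeasure) (hC : ∀ᵐ ζ ∂circleMeasure, ‖g ζ‖ ≤ C) :
    MemLp (fun ζ => f ζ * g ζ) 2 circleMeasure :=
  MemLp.mul' (MemLp.of_bound hg C hC : MemLp g ∞ circleMeasure) hf

/-- A bounded `Γ`-invariant real function is `log |h|` for an invertible bounded analytic function
`h`, which is automorphic for some character of `Γ`. -/
theorem exists_outer {u : Circle → ℝ} (hu : Measurable u) {C : ℝ}
    (hC : ∀ ζ, |u ζ| ≤ C)
    (hinv : ∀ γ : Γ, (fun ζ => u (boundaryMap γ ζ)) =ᵐ[circleMeasure] u) :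
    ∃ (σ : Γ →* Circle) (h : Circle → ℂ), IsHardy h ∧ (IsHardy fun ζ => (h ζ)⁻¹) ∧
      (∀ᵐ ζ ∂circleMeasure, ‖h ζ‖ = Real.exp (u ζ)) ∧
      ∀ γ : Γ, (fun ζ => h (boundaryMap γ ζ)) =ᵐ[circleMeasure] fun ζ => (σ γ : ℂ) * h ζ := by
  obtain ⟨p, S, hp, hS, hSu⟩ := exists_herglotz hu hC
  have hp1 : ∀ k (ζ : Circle), ((p k).eval (ζ : ℂ)).re ≤ C + 1 := fun k ζ => (abs_le.1 (hp k ζ)).2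
  have hp2 : ∀ k (ζ : Circle), ((-p k).eval (ζ : ℂ)).re ≤ C + 1 := fun k ζ => by
    have := (abs_le.1 (hp k ζ)).1
    simp only [Polynomial.eval_neg, neg_re]
    linarith
  have hS2 : ∀ᵐ ζ : Circle ∂circleMeasure,
      Tendsto (fun k => (-p k).eval (ζ : ℂ)) atTop (𝓝 (-S ζ)) := by
    filter_upwards [hS] with ζ h
    simpa using h.neg
  have hH1 := isHardy_exp_comp hp1 hS
  have hH2 := isHardy_exp_comp (S := fun ζ => -S ζ) hp2 hS2
  have h1 : IsHardy fun ζ => exp (S ζ) := by simpa only [boundaryMap_one] using hH1 1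
  have h2 : IsHardy fun ζ => exp (-S ζ) := by simpa only [boundaryMap_one] using hH2 1
  have hb1 : ∀ᵐ ζ ∂circleMeasure, ‖exp (S ζ)‖ ≤ Real.exp C := by
    filter_upwards [hSu] with ζ h
    rw [norm_exp, h]
    exact Real.exp_le_exp.2 (abs_le.1 (hC ζ)).2
  have hb2 : ∀ᵐ ζ ∂circleMeasure, ‖exp (-S ζ)‖ ≤ Real.exp C := by
    filter_upwards [hSu] with ζ h
    rw [norm_exp, neg_re, h]
    exact Real.exp_le_exp.2 (by linarith [(abs_le.1 (hC ζ)).1])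
  have key : ∀ γ : Γ, ∃ c : Circle,
      (fun ζ => exp (S (boundaryMap γ ζ))) =ᵐ[circleMeasure] fun ζ => (c : ℂ) * exp (S ζ) := by
    intro γ
    have hq1 : IsHardy fun ζ => exp (S (boundaryMap γ ζ)) * exp (-S ζ) :=
      (hH1 γ).mul h2 (memLp_mul_of_bound (hH1 γ).1 h2.1.1 hb2)
    have hq2 : IsHardy fun ζ => exp (-S (boundaryMap γ ζ)) * exp (S ζ) :=
      (hH2 γ).mul h1 (memLp_mul_of_bound (hH2 γ).1 h1.1.1 hb1)
    have hre : ∀ᵐ ζ ∂circleMeasure, (S (boundaryMap γ ζ)).re = (S ζ).re := by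
      filter_upwards [hSu, (quasiMeasurePreserving_boundaryMap γ).ae hSu, hinv γ] with ζ e1 e2 e3
      rw [e1, e2, e3]
    -- The quotient is unimodular by invariance of `u`, so its conjugate is its inverse, which is in
    -- `H²` by `hq2`.
    have hq3 : IsHardy fun ζ => conj (exp (S (boundaryMap γ ζ)) * exp (-S ζ)) := by
      refine hq2.congr ?_
      filter_upwards [hre] with ζ h
      rw [← Complex.exp_add, ← Complex.exp_add, ← exp_conj]
      congr 1
      apply Complex.ext <;> simp [h]
    obtain ⟨c, hc⟩ := hq1.eq_const hq3
    have hcn : ‖c‖ = 1 := by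
      obtain ⟨ζ, h, h'⟩ := (hc.and hre).exists
      simp only at h
      rw [← h, ← Complex.exp_add, norm_exp]
      simp [h']
    refine ⟨⟨c, by simpa [Submonoid.unitSphere] using hcn⟩, ?_⟩
    filter_upwards [hc] with ζ h
    show _ = c * exp (S ζ)
    rw [← h, mul_assoc, ← Complex.exp_add]
    simp
  choose σ hσ using key
  have hmul : ∀ γ δ : Γ, σ (γ * δ) = σ γ * σ δ := fun γ δ => by
    -- One point where the three almost everywhere relations hold suffices, since the constants do
    -- not depend on it and `exp` never vanishes.
    obtain ⟨ζ, ⟨e1, e2⟩, e3⟩ := (((hσ (γ * δ)).and (hσ δ)).and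
      ((quasiMeasurePreserving_boundaryMap δ).ae (hσ γ))).exists
    apply Circle.ext
    have e4 : exp (S (boundaryMap (γ * δ : Γ) ζ)) = exp (S (boundaryMap γ (boundaryMap δ ζ))) := by
      rw [Subgroup.coe_mul, boundaryMap_mul]
    simp only at e1 e2 e3
    rw [e1, e3, e2, ← mul_assoc] at e4
    exact mul_right_cancel₀ (exp_ne_zero _) e4
  refine ⟨MonoidHom.mk' σ hmul, fun ζ => exp (S ζ), h1, ?_, ?_, hσ⟩
  · simpa only [Complex.exp_neg] using h2
  · filter_upwards [hSu] with ζ h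
    rw [norm_exp, h]

/-! ### Automorphic functions and kernels -/

/-- The automorphy relation `f ∘ γ = σ(γ) f` almost everywhere, for all `γ ∈ Γ`. -/
def IsAutomorphic (σ : Γ →* Circle) (f : Circle → ℂ) : Prop :=
  ∀ γ : Γ, (fun ζ => f (boundaryMap γ ζ)) =ᵐ[circleMeasure] fun ζ => (σ γ : ℂ) * f ζ

theorem IsAutomorphic.congr {σ : Γ →* Circle} {f g : Circle → ℂ} (hf : IsAutomorphic σ f)
    (h : f =ᵐ[circleMeasure] g) : IsAutomorphic σ g := fun γ => by
  filter_upwards [hf γ, h, (quasiMeasurePreserving_boundaryMap γ).ae h] with ζ h1 h2 h3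
  rw [← h2, ← h3, h1]

theorem IsAutomorphic.mul {σ τ : Γ →* Circle} {f g : Circle → ℂ} (hf : IsAutomorphic σ f)
    (hg : IsAutomorphic τ g) : IsAutomorphic (σ * τ) fun ζ => f ζ * g ζ := fun γ => by
  filter_upwards [hf γ, hg γ] with ζ h1 h2
  rw [h1, h2, MonoidHom.mul_apply, Circle.coe_mul]
  ring

theorem IsAutomorphic.inv {σ : Γ →* Circle} {f : Circle → ℂ} (hf : IsAutomorphic σ f) :
    IsAutomorphic σ⁻¹ fun ζ => (f ζ)⁻¹ := fun γ => by
  filter_upwards [hf γ] with ζ h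
  rw [h, MonoidHom.inv_apply, Circle.coe_inv, mul_inv]

theorem toLp_mem_hardyChar {σ : Γ →* Circle} {f : Circle → ℂ} (hf : IsHardy f)
    (ha : IsAutomorphic σ f) : hf.1.toLp f ∈ HardyChar 2 σ :=
  ⟨hf.toLp_mem, ha.congr hf.1.coeFn_toLp.symm⟩

/-- The kernel function of `H²_σ` at a point of the disc, as an element of `L²`. -/
def kernelFun (σ : Γ →* Circle) (z : 𝔻) : Lp ℂ 2 circleMeasure :=
  (RKHS.kerFun (HardyChar 2 σ) z 1 : HardyChar 2 σ)

theorem kernelFun_mem (σ : Γ →* Circle) (z : 𝔻) : kernelFun σ z ∈ HardyChar 2 σ :=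
  Subtype.property _

theorem inner_kernelFun {σ : Γ →* Circle} (z : 𝔻) {f : Lp ℂ 2 circleMeasure}
    (hf : f ∈ HardyChar 2 σ) : ⟪f, kernelFun σ z⟫_ℂ = conj (valueAt z f) := by
  have h := RKHS.inner_kerFun (H := HardyChar 2 σ) z (1 : ℂ) ⟨f, hf⟩
  rw [RCLike.inner_apply, one_mul] at h
  exact h.trans (congrArg conj (valueCLM_apply f z))

theorem kernelChar_eq_inner (σ : Γ →* Circle) (z w : 𝔻) :
    kernelChar σ z w = ⟪kernelFun σ z, kernelFun σ w⟫_ℂ := by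
  have h := RKHS.kernel_inner (HardyChar 2 σ) z w (1 : ℂ) 1
  rw [RCLike.inner_apply, one_mul] at h
  rw [← inner_conj_symm]
  exact (conj_conj _).symm.trans (congrArg conj h)

theorem sum_kernelFun_mem (σ : Γ →* Circle) {n : ℕ} (z : Fin n → 𝔻) (d : Fin n → ℂ) :
    ∑ j, d j • kernelFun σ (z j) ∈ HardyChar 2 σ :=
  Submodule.sum_mem _ fun j _ => Submodule.smul_mem _ _ (kernelFun_mem σ (z j))

theorem inner_sum_kernelFun {σ : Γ →* Circle} {n : ℕ} (z : Fin n → 𝔻) (d : Fin n → ℂ)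
    {f : Lp ℂ 2 circleMeasure} (hf : f ∈ HardyChar 2 σ) :
    ⟪f, ∑ j, d j • kernelFun σ (z j)⟫_ℂ = ∑ j, d j * conj (valueAt (z j) f) := by
  rw [inner_sum]
  exact Finset.sum_congr rfl fun j _ => by rw [inner_smul_right, inner_kernelFun _ hf]

open scoped ComplexOrder in
/-- The Pick matrix is positive semidefinite if and only if `k_{z_j} ↦ conj (w_j) k_{z_j}` is a
contraction. -/
theorem posSemidef_pick_iff {σ : Γ →* Circle} {n : ℕ} (z : Fin n → 𝔻) (w : Fin n → ℂ) :
    (Matrix.of fun i j => (1 - w i * conj (w j)) * kernelChar σ (z i) (z j)).PosSemidef ↔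
      ∀ d : Fin n → ℂ, ‖∑ j, (d j * conj (w j)) • kernelFun σ (z j)‖
        ≤ ‖∑ j, d j • kernelFun σ (z j)‖ := by
  have hherm : (Matrix.of fun i j =>
      (1 - w i * conj (w j)) * kernelChar σ (z i) (z j)).IsHermitian := by
    ext i j
    simp only [Matrix.conjTranspose_apply, Matrix.of_apply, star_mul', RCLike.star_def,
      kernelChar_eq_inner, inner_conj_symm, map_sub, map_mul, map_one, conj_conj]
    ring
  have key : ∀ d : Fin n → ℂ, star d ⬝ᵥ (Matrix.of fun i j =>
      (1 - w i * conj (w j)) * kernelChar σ (z i) (z j)).mulVec d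
      = ((‖∑ j, d j • kernelFun σ (z j)‖ ^ 2
        - ‖∑ j, (d j * conj (w j)) • kernelFun σ (z j)‖ ^ 2 : ℝ) : ℂ) := fun d => by
    push_cast
    have e : ∀ x : Lp ℂ 2 circleMeasure, (‖x‖ : ℂ) ^ 2 = ⟪x, x⟫_ℂ := fun x =>
      (inner_self_eq_norm_sq_to_K (𝕜 := ℂ) x).symm
    rw [e, e]
    simp only [dotProduct, Matrix.mulVec, Matrix.of_apply, Finset.mul_sum, inner_sum, sum_inner,
      inner_smul_left, inner_smul_right, Pi.star_apply, RCLike.star_def, kernelChar_eq_inner]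
    rw [Finset.sum_comm, ← Finset.sum_sub_distrib]
    refine Finset.sum_congr rfl fun j _ => ?_
    rw [← Finset.sum_sub_distrib]
    refine Finset.sum_congr rfl fun i _ => ?_
    simp only [map_mul, conj_conj]
    ring
  rw [Matrix.posSemidef_iff_dotProduct_mulVec]
  refine ⟨fun h d => ?_, fun h => ⟨hherm, fun d => ?_⟩⟩
  · have h1 := h.2 d
    rw [key, zero_le_real] at h1
    exact abs_le_of_sq_le_sq' (by linarith) (norm_nonneg _) |>.2
  · rw [key, zero_le_real, sub_nonneg]
    gcongr
    exact h d

theorem L2_inner_eq (f g : Lp ℂ 2 circleMeasure) :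
    ⟪f, g⟫_ℂ = ∫ ζ, g ζ * conj (f ζ) ∂circleMeasure := by
  rw [L2.inner_def]
  rfl

theorem norm_sq_eq_integral (f : Lp ℂ 2 circleMeasure) :
    ‖f‖ ^ 2 = ∫ ζ, ‖f ζ‖ ^ 2 ∂circleMeasure := by
  conv_lhs => rw [← Lp.toLp_coeFn f (Lp.memLp f)]
  exact norm_toLp_sq _

theorem integrable_norm_sq {f : Circle → ℂ} (hf : MemLp f 2 circleMeasure) :
    Integrable (fun ζ => ‖f ζ‖ ^ 2) circleMeasure := by
  simpa using hf.norm.integrable_sq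

theorem ae_norm_le_of_norm_le {f : Lp ℂ ∞ circleMeasure} {C : ℝ} (hf : ‖f‖ ≤ C) :
    ∀ᵐ ζ ∂circleMeasure, ‖f ζ‖ ≤ C := by
  filter_upwards [ae_le_eLpNormEssSup (f := f) (μ := circleMeasure)] with ζ h
  refine le_trans ?_ hf
  rw [← eLpNorm_exponent_top, ← Lp.enorm_def] at h
  simpa using ENNReal.toReal_mono enorm_ne_top h

/-! ### Necessity: multiplication by a bounded analytic function -/

/-- The adjoint of multiplication by `f` sends `Q` to `G`. Written without adjoints: `P = f G` stays
in `H²_σ`, `‖P‖ ≤ ‖G‖`, and `‖G‖² = ⟪P, Q⟫ ≤ ‖G‖ ‖Q‖`. -/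
theorem norm_sum_kernelFun_le_of_interpolation {n : ℕ} {z : Fin n → 𝔻} {w : Fin n → ℂ}
    {f : Lp ℂ ∞ circleMeasure} (hf : f ∈ HardyInv ∞ Γ) (hf1 : ‖f‖ ≤ 1)
    (hfw : ∀ j, valueAt (z j) f = w j) (σ : Γ →* Circle) (d : Fin n → ℂ) :
    ‖∑ j, (d j * conj (w j)) • kernelFun σ (z j)‖ ≤ ‖∑ j, d j • kernelFun σ (z j)‖ := by
  set G := ∑ j, (d j * conj (w j)) • kernelFun σ (z j) with hG
  set Q := ∑ j, d j • kernelFun σ (z j) with hQ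
  have hGmem : G ∈ HardyChar 2 σ := sum_kernelFun_mem σ z _
  have hb := ae_norm_le_of_norm_le hf1
  have hfH := isHardy_coe_infty hf.1
  have hGH := isHardy_coe hGmem.1
  have hm : MemLp (fun ζ => G ζ * f ζ) 2 circleMeasure :=
    memLp_mul_of_bound hGH.1 hfH.1.1 hb
  have hH := hGH.mul hfH hm
  have ha : IsAutomorphic σ fun ζ => G ζ * f ζ := by
    have h1 : IsAutomorphic (σ * 1) fun ζ => G ζ * f ζ :=
      IsAutomorphic.mul hGmem.2 hf.2
    rwa [mul_one] at h1
  have hPmem := toLp_mem_hardyChar hH ha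
  set P := hH.1.toLp _
  have hPG : ‖P‖ ≤ ‖G‖ := by
    refine abs_le_of_sq_le_sq' ?_ (norm_nonneg _) |>.2
    have e1 : ‖P‖ ^ 2 = _ := norm_toLp_sq hH.1
    have e2 : ‖G‖ ^ 2 = _ := norm_sq_eq_integral G
    rw [e1, e2]
    refine integral_mono_ae (integrable_norm_sq hH.1) (integrable_norm_sq hGH.1) ?_
    filter_upwards [hb] with ζ h
    rw [norm_mul]
    gcongr
    exact mul_le_of_le_one_right (norm_nonneg _) h
  have hinner : ⟪G, G⟫_ℂ = ⟪P, Q⟫_ℂ := by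
    conv_lhs => rhs; rw [hG]
    rw [hQ, inner_sum_kernelFun z _ hGmem, inner_sum_kernelFun z _ hPmem]
    refine Finset.sum_congr rfl fun j _ => ?_
    have e : valueAt (z j) P
        = valueAt (z j) G * w j := by
      rw [← hfw j, ← hGH.valueAt_mul hfH]
      exact valueAt_congr hH.1.coeFn_toLp _
    rw [e, map_mul]
    ring
  have h1 : ‖G‖ ^ 2 ≤ ‖G‖ * ‖Q‖ := by
    calc ‖G‖ ^ 2 = ‖⟪G, G⟫_ℂ‖ := by rw [inner_self_eq_norm_sq_to_K]; simp
      _ ≤ ‖P‖ * ‖Q‖ := by rw [hinner]; exact norm_inner_le_norm _ _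
      _ ≤ ‖G‖ * ‖Q‖ := by gcongr
  rcases (norm_nonneg G).eq_or_lt with h0 | h0
  · rw [← h0]; exact norm_nonneg _
  · rw [sq] at h1
    exact le_of_mul_le_mul_left h1 h0

/-! ### Sufficiency: factorization through automorphic outer functions -/

/-- With `t = |v|` the left side is `|k|²`. The quotient is at most `t` below the truncation level
`1 / ε` and at most `ε t²` above it. -/
theorem norm_sq_div_le {t ε : ℝ} (ht : 0 ≤ t) (hε : 0 < ε) :
    t ^ 2 / (min t (1 / ε) + ε) ≤ t + ε * t ^ 2 := by
  have hm : 0 < min t (1 / ε) + ε := by positivity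
  rw [div_le_iff₀ hm]
  rcases le_total t (1 / ε) with h | h
  · rw [min_eq_left h]
    have : 0 ≤ ε * t ^ 2 * (t + ε) + t * ε := by positivity
    nlinarith
  · rw [min_eq_right h]
    have e : ε * t ^ 2 * (1 / ε) = t ^ 2 := by field_simp
    have : 0 ≤ t * (1 / ε + ε) + ε * t ^ 2 * ε := by positivity
    nlinarith

/-- The factorization `v = k · conj h`, with the two factors on the right bounding `‖h‖²` and
`‖k‖²`. -/
theorem norm_sum_sq_le {n : ℕ} {z : Fin n → 𝔻} {w : Fin n → ℂ}
    (hA : ∀ (σ : Γ →* Circle) (d : Fin n → ℂ),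
      ‖∑ j, (d j * conj (w j)) • kernelFun σ (z j)‖ ≤ ‖∑ j, d j • kernelFun σ (z j)‖)
    {v : Lp ℂ 2 circleMeasure} (hv : IsAutomorphic (1 : Γ →* Circle) v) {c : Fin n → ℂ}
    (hvc : ∀ F ∈ HardyInv 2 Γ, ⟪F, v⟫_ℂ = ∑ j, c j * conj (valueAt (z j) F))
    {ε : ℝ} (hε : 0 < ε) :
    ‖∑ j, c j * conj (w j)‖ ^ 2 ≤ (∫ ζ, ‖v ζ‖ ∂circleMeasure + ε)
      * (∫ ζ, ‖v ζ‖ ∂circleMeasure + ε * ∫ ζ, ‖v ζ‖ ^ 2 ∂circleMeasure) := by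
  have hvi : Integrable (fun ζ => ‖v ζ‖) circleMeasure :=
    ((Lp.memLp v).integrable (by norm_num)).norm
  have hvi2 : Integrable (fun ζ => ‖v ζ‖ ^ 2) circleMeasure := integrable_norm_sq (Lp.memLp v)
  -- `b` replaces `|v|` as the value of `|h|²`: it lies between `ε` and `1 / ε + ε`, so its
  -- logarithm is bounded, as `exists_outer` requires.
  set b : Circle → ℝ := fun ζ => min ‖v ζ‖ (1 / ε) + ε with hb
  have hbε : ∀ ζ, ε ≤ b ζ := fun ζ => le_add_of_nonneg_left (by positivity)
  have hb0 : ∀ ζ, 0 < b ζ := fun ζ => hε.trans_le (hbε ζ)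
  have hbR : ∀ ζ, b ζ ≤ 1 / ε + ε := fun ζ => add_le_add_left (min_le_right _ _) _
  have hbm : Measurable b :=
    ((Lp.stronglyMeasurable v).measurable.norm.min measurable_const).add_const ε
  set C := |Real.log ε| + |Real.log (1 / ε + ε)| with hCdef
  have hC : ∀ ζ, |Real.log (b ζ) / 2| ≤ C := fun ζ => by
    have h1 := Real.log_le_log hε (hbε ζ)
    have h2 := Real.log_le_log (hb0 ζ) (hbR ζ)
    have h3 := neg_abs_le (Real.log ε)
    have h4 := le_abs_self (Real.log (1 / ε + ε))
    have h5 := abs_nonneg (Real.log ε)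
    have h6 := abs_nonneg (Real.log (1 / ε + ε))
    rw [abs_le]
    constructor <;> linarith
  obtain ⟨σ, h, hh, hh', hnorm, hauto⟩ := exists_outer (Γ := Γ) (u := fun ζ => Real.log (b ζ) / 2)
    ((Real.measurable_log.comp hbm).div_const 2) hC (fun γ => by
      filter_upwards [hv γ] with ζ e
      simp [hb, e])
  have hnsq : ∀ᵐ ζ ∂circleMeasure, ‖h ζ‖ ^ 2 = b ζ := by
    filter_upwards [hnorm] with ζ e
    rw [e, ← Real.exp_nat_mul]
    push_cast
    rw [mul_div_cancel₀ _ two_ne_zero, Real.exp_log (hb0 ζ)]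
  have hbd : ∀ᵐ ζ ∂circleMeasure, ‖(h ζ)⁻¹‖ ≤ Real.exp C := by
    filter_upwards [hnorm] with ζ e
    rw [norm_inv, e, ← Real.exp_neg]
    exact Real.exp_le_exp.2 (by linarith [(abs_le.1 (hC ζ)).1])
  have hne : ∀ᵐ ζ ∂circleMeasure, h ζ ≠ 0 := by
    filter_upwards [hnorm] with ζ e
    rw [← norm_pos_iff, e]
    exact Real.exp_pos _
  have hval : ∀ x : 𝔻, valueAt x (fun ζ => (h ζ)⁻¹) * valueAt x h = 1 := fun x => by
    rw [← hh'.valueAt_mul hh, ← valueAt_const x 1]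
    refine valueAt_congr ?_ x
    filter_upwards [hne] with ζ e using inv_mul_cancel₀ e
  have hmk : MemLp (fun ζ => v ζ * conj (h ζ)⁻¹) 2 circleMeasure :=
    memLp_mul_of_bound (Lp.memLp v) (continuous_conj.comp_aestronglyMeasurable hh'.1.1)
      (by simpa only [RCLike.norm_conj] using hbd)
  set k := hmk.toLp _ with hk
  -- These are the coefficients of the projection of `k` to `H²_σ`: for `F ∈ H²_σ` the pairing with
  -- `k` is that of the invariant function `F / h` with `v`.
  set d : Fin n → ℂ := fun j => c j * conj (valueAt (z j) fun ζ => (h ζ)⁻¹) with hd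
  have hinner : ∀ F ∈ HardyChar 2 σ, ⟪F, k⟫_ℂ = ⟪F, ∑ j, d j • kernelFun σ (z j)⟫_ℂ := by
    intro F hF
    have hFH := isHardy_coe hF.1
    have hP := hFH.mul hh' (memLp_mul_of_bound hFH.1 hh'.1.1 hbd)
    have hPa : IsAutomorphic (1 : Γ →* Circle) fun ζ => F ζ * (h ζ)⁻¹ := by
      have e : IsAutomorphic (σ * σ⁻¹) fun ζ => F ζ * (h ζ)⁻¹ :=
        IsAutomorphic.mul hF.2 (IsAutomorphic.inv hauto)
      rwa [mul_inv_cancel] at e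
    have e1 : ⟪F, k⟫_ℂ = ⟪hP.1.toLp _, v⟫_ℂ := by
      rw [L2_inner_eq, L2_inner_eq]
      refine integral_congr_ae ?_
      filter_upwards [hmk.coeFn_toLp, hP.1.coeFn_toLp] with ζ e1 e2
      rw [e1, e2, map_mul]
      ring
    rw [e1, hvc _ (toLp_mem_hardyChar hP hPa), inner_sum_kernelFun z d hF]
    refine Finset.sum_congr rfl fun j _ => ?_
    rw [valueAt_congr hP.1.coeFn_toLp, hFH.valueAt_mul hh', map_mul, hd]
    ring
  have hq : ‖∑ j, d j • kernelFun σ (z j)‖ ≤ ‖k‖ := by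
    have hmem := sum_kernelFun_mem σ z d
    set q := ∑ j, d j • kernelFun σ (z j)
    have e : ‖q‖ * ‖q‖ ≤ ‖q‖ * ‖k‖ := by
      have e0 : ‖⟪q, q⟫_ℂ‖ = ‖q‖ * ‖q‖ := by rw [inner_self_eq_norm_sq_to_K]; simp [sq]
      rw [← e0, ← hinner q hmem]
      exact norm_inner_le_norm _ _
    rcases (norm_nonneg q).eq_or_lt with h0 | h0
    · rw [← h0]; exact norm_nonneg _
    · exact le_of_mul_le_mul_left e h0
  -- Pairing with `h` multiplies `d_j` by `conj h(z_j)`, which cancels the value of `1 / h` and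
  -- restores `c_j`.
  have hsum : ⟪hh.1.toLp h, ∑ j, (d j * conj (w j)) • kernelFun σ (z j)⟫_ℂ
      = ∑ j, c j * conj (w j) := by
    rw [inner_sum_kernelFun z _ (toLp_mem_hardyChar hh hauto)]
    refine Finset.sum_congr rfl fun j _ => ?_
    have e := congrArg conj (hval (z j))
    rw [map_mul, map_one] at e
    rw [valueAt_congr hh.1.coeFn_toLp, hd]
    linear_combination (c j * conj (w j)) * e
  have hle : ‖∑ j, c j * conj (w j)‖ ≤ ‖hh.1.toLp h‖ * ‖k‖ := by
    rw [← hsum]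
    exact (norm_inner_le_norm _ _).trans (by gcongr; exact (hA σ d).trans hq)
  have hN : ‖hh.1.toLp h‖ ^ 2 ≤ ∫ ζ, ‖v ζ‖ ∂circleMeasure + ε := by
    rw [norm_toLp_sq]
    calc _ ≤ ∫ ζ, (‖v ζ‖ + ε) ∂circleMeasure := by
          refine integral_mono_ae (integrable_norm_sq hh.1) (hvi.add (integrable_const ε)) ?_
          filter_upwards [hnsq] with ζ e
          rw [e]
          exact add_le_add_left (min_le_left _ _) _
      _ = _ := by
          rw [integral_add hvi (integrable_const ε)]
          simp
  have hK : ‖k‖ ^ 2 ≤ ∫ ζ, ‖v ζ‖ ∂circleMeasure + ε * ∫ ζ, ‖v ζ‖ ^ 2 ∂circleMeasure := by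
    rw [hk, norm_toLp_sq]
    calc _ ≤ ∫ ζ, (‖v ζ‖ + ε * ‖v ζ‖ ^ 2) ∂circleMeasure := by
          refine integral_mono_ae (integrable_norm_sq hmk) (hvi.add (hvi2.const_mul ε)) ?_
          filter_upwards [hnsq] with ζ e
          rw [norm_mul, RCLike.norm_conj, mul_pow, norm_inv, inv_pow, e, ← div_eq_mul_inv]
          exact norm_sq_div_le (norm_nonneg _) hε
      _ = _ := by rw [integral_add hvi (hvi2.const_mul ε), integral_const_mul]
  calc _ ≤ (‖hh.1.toLp h‖ * ‖k‖) ^ 2 := by gcongr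
    _ = ‖hh.1.toLp h‖ ^ 2 * ‖k‖ ^ 2 := mul_pow _ _ _
    _ ≤ _ := by gcongr

theorem norm_sum_le_integral {n : ℕ} {z : Fin n → 𝔻} {w : Fin n → ℂ}
    (hA : ∀ (σ : Γ →* Circle) (d : Fin n → ℂ),
      ‖∑ j, (d j * conj (w j)) • kernelFun σ (z j)‖ ≤ ‖∑ j, d j • kernelFun σ (z j)‖)
    {v : Lp ℂ 2 circleMeasure} (hv : IsAutomorphic (1 : Γ →* Circle) v) {c : Fin n → ℂ}
    (hvc : ∀ F ∈ HardyInv 2 Γ, ⟪F, v⟫_ℂ = ∑ j, c j * conj (valueAt (z j) F)) :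
    ‖∑ j, c j * conj (w j)‖ ≤ ∫ ζ, ‖v ζ‖ ∂circleMeasure := by
  set N := ∫ ζ, ‖v ζ‖ ∂circleMeasure with hN
  set M := ∫ ζ, ‖v ζ‖ ^ 2 ∂circleMeasure with hM
  have hlim : Tendsto (fun ε : ℝ => (N + ε) * (N + ε * M)) (𝓝[>] 0) (𝓝 (N ^ 2)) := by
    have h1 : Continuous fun ε : ℝ => (N + ε) * (N + ε * M) := by fun_prop
    have h2 := (h1.tendsto 0).mono_left (nhdsWithin_le_nhds (s := Ioi 0))
    simpa [sq] using h2
  have h : ‖∑ j, c j * conj (w j)‖ ^ 2 ≤ N ^ 2 :=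
    ge_of_tendsto hlim (by
      filter_upwards [self_mem_nhdsWithin] with ε hε using norm_sum_sq_le hA hv hvc hε)
  exact abs_le_of_sq_le_sq' h (integral_nonneg fun ζ => norm_nonneg _) |>.2

/-! ### Sufficiency: duality -/

/-- The closed subspace of `Γ`-invariant functions in `L²`. -/
def invariantL2 (Γ : Subgroup DiscAut) : Submodule ℂ (Lp ℂ 2 circleMeasure) where
  carrier := {f | IsAutomorphic (1 : Γ →* Circle) f}
  add_mem' := fun {f g} hf hg => IsAutomorphic.congr (f := fun ζ => f ζ + g ζ) (fun γ => by
    filter_upwards [hf γ, hg γ] with ζ h1 h2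
    rw [h1, h2, mul_add]) (Lp.coeFn_add f g).symm
  zero_mem' := IsAutomorphic.congr (f := fun _ => 0) (fun γ => by simp)
    (Lp.coeFn_zero ℂ 2 circleMeasure).symm
  smul_mem' := fun c f hf => IsAutomorphic.congr (f := fun ζ => c * f ζ) (fun γ => by
    filter_upwards [hf γ] with ζ h1
    rw [h1, mul_left_comm]) (Lp.coeFn_smul c f).symm

theorem isClosed_invariantL2 : IsClosed (invariantL2 Γ : Set (Lp ℂ 2 circleMeasure)) := by
  refine isClosed_of_closure_subset fun f hf γ => ?_
  obtain ⟨u, hu, hlim⟩ := mem_closure_iff_seq_limit.1 hf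
  obtain ⟨ns, -, hns⟩ := (tendstoInMeasure_of_tendsto_Lp hlim).exists_seq_tendsto_ae
  filter_upwards [hns, ae_all_iff.2 fun k => hu k γ,
    (quasiMeasurePreserving_boundaryMap γ).ae hns] with ζ h2 h3 h4
  refine tendsto_nhds_unique h4 ?_
  simp_rw [h3]
  exact h2.const_mul _

instance : CompleteSpace (invariantL2 Γ) := isClosed_invariantL2.isComplete.completeSpace_coe

theorem hardyInv_le_invariantL2 : HardyInv 2 Γ ≤ invariantL2 Γ := fun _ hf => hf.2

/-- A functional dominated by the norm of the image under a linear map is induced by a functional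
of norm at most one. -/
theorem exists_functional_comp_eq {X Y : Type*} [AddCommGroup X] [Module ℂ X]
    [NormedAddCommGroup Y] [NormedSpace ℂ Y] (Φ : X →ₗ[ℂ] Y) (ℓ : X →ₗ[ℂ] ℂ)
    (h : ∀ x, ‖ℓ x‖ ≤ ‖Φ x‖) : ∃ L : Y →L[ℂ] ℂ, ‖L‖ ≤ 1 ∧ ∀ x, L (Φ x) = ℓ x := by
  obtain ⟨s, hs⟩ := Φ.rangeRestrict.exists_rightInverse_of_surjective Φ.range_rangeRestrict
  have hs' : ∀ y : LinearMap.range Φ, Φ (s y) = y := fun y =>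
    congrArg Subtype.val (LinearMap.congr_fun hs y)
  let g : LinearMap.range Φ →L[ℂ] ℂ := (ℓ ∘ₗ s).mkContinuous 1 fun y => by
    rw [one_mul, LinearMap.comp_apply]
    refine (h (s y)).trans_eq ?_
    rw [hs', Submodule.coe_norm]
  obtain ⟨L, hL, hLn⟩ := exists_extension_norm_eq (LinearMap.range Φ) g
  refine ⟨L, hLn.trans_le (LinearMap.mkContinuous_norm_le _ zero_le_one _), fun x => ?_⟩
  have h1 : L (Φ x) = ℓ (s ⟨Φ x, x, rfl⟩) := hL ⟨Φ x, x, rfl⟩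
  -- The bound forces `ℓ` to vanish on the kernel of `Φ`, so the choice of preimage is immaterial.
  have h2 := h (s ⟨Φ x, x, rfl⟩ - x)
  rw [map_sub, map_sub, hs', sub_self, norm_zero, norm_le_zero_iff, sub_eq_zero] at h2
  rw [h1, h2]

theorem memLp_one {f : Circle → ℂ} (hf : MemLp f 2 circleMeasure) : MemLp f 1 circleMeasure :=
  hf.mono_exponent (by norm_num)

/-- The inclusion of `L²` in `L¹`. -/
def inclL1 : Lp ℂ 2 circleMeasure →ₗ[ℂ] Lp ℂ 1 circleMeasure where
  toFun f := (memLp_one (Lp.memLp f)).toLp f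
  map_add' f g := by
    rw [← MemLp.toLp_add]
    exact MemLp.toLp_congr _ _ (Lp.coeFn_add f g)
  map_smul' c f := by
    rw [RingHom.id_apply, ← MemLp.toLp_const_smul]
    exact MemLp.toLp_congr _ _ (Lp.coeFn_smul c f)

theorem norm_inclL1 (f : Lp ℂ 2 circleMeasure) : ‖inclL1 f‖ = ∫ ζ, ‖f ζ‖ ∂circleMeasure := by
  rw [L1.norm_eq_integral_norm]
  refine integral_congr_ae ?_
  filter_upwards [(memLp_one (Lp.memLp f)).coeFn_toLp] with ζ h
  rw [← h]
  rfl

theorem norm_inclL1_le (f : Lp ℂ 2 circleMeasure) : ‖inclL1 f‖ ≤ ‖f‖ := by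
  have h : ‖inclL1 f‖ = (eLpNorm f 1 circleMeasure).toReal := 
    Lp.norm_toLp _ (memLp_one (Lp.memLp f))
  rw [h, Lp.norm_def]
  refine ENNReal.toReal_mono (Lp.eLpNorm_ne_top f) ?_
  exact eLpNorm_le_eLpNorm_of_exponent_le (by norm_num) (Lp.aestronglyMeasurable f)

/-- An invariant function that defines a functional bounded by the `L¹` norm on the invariant
functions is bounded by one. -/
theorem ae_norm_le_one_of_inner_le {f : Lp ℂ 2 circleMeasure} (hf : f ∈ invariantL2 Γ)
    (h : ∀ v ∈ invariantL2 Γ, ‖⟪f, v⟫_ℂ‖ ≤ ∫ ζ, ‖v ζ‖ ∂circleMeasure) :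
    ∀ᵐ ζ ∂circleMeasure, ‖f ζ‖ ≤ 1 := by
  -- The test function is `f` restricted to the invariant set `A`. It gives `∫_A |f|² ≤ ∫_A |f|`,
  -- although `|f|² > |f|` on `A`.
  set A : Set Circle := {ζ | 1 < ‖f ζ‖} with hA
  have hAm : MeasurableSet A :=
    measurableSet_lt measurable_const (Lp.stronglyMeasurable f).measurable.norm
  have hm : MemLp (A.indicator f) 2 circleMeasure := (Lp.memLp f).indicator hAm
  have hinv : hm.toLp _ ∈ invariantL2 Γ := by
    refine IsAutomorphic.congr (f := A.indicator f) (fun γ => ?_) hm.coeFn_toLp.symm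
    filter_upwards [hf γ] with ζ e
    simp only [MonoidHom.one_apply, Circle.coe_one, one_mul] at e ⊢
    simp only [indicator, hA, mem_ofPred_eq, e]
  have h1 := h _ hinv
  have hi1 : Integrable (fun ζ => ‖A.indicator f ζ‖) circleMeasure :=
    (hm.integrable (by norm_num)).norm
  have hi2 := integrable_norm_sq hm
  have e1 : ⟪f, hm.toLp _⟫_ℂ = ((∫ ζ, ‖A.indicator f ζ‖ ^ 2 ∂circleMeasure : ℝ) : ℂ) := by
    rw [L2_inner_eq]
    refine (integral_congr_ae ?_).trans integral_complex_ofReal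
    filter_upwards [hm.coeFn_toLp] with ζ e
    rw [e]
    by_cases hζ : ζ ∈ A
    · rw [indicator_of_mem hζ, mul_conj, normSq_eq_norm_sq]
    · simp [indicator_of_notMem hζ]
  have e2 : ∫ ζ, ‖(hm.toLp _) ζ‖ ∂circleMeasure = ∫ ζ, ‖A.indicator f ζ‖ ∂circleMeasure :=
    integral_congr_ae (by filter_upwards [hm.coeFn_toLp] with ζ e; rw [e])
  rw [e1, e2, norm_real, Real.norm_eq_abs, abs_of_nonneg (integral_nonneg fun ζ => sq_nonneg _)]
    at h1
  have hnn : ∀ ζ, 0 ≤ ‖A.indicator f ζ‖ ^ 2 - ‖A.indicator f ζ‖ := fun ζ => by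
    by_cases hζ : ζ ∈ A
    · rw [indicator_of_mem hζ]
      have : 1 < ‖f ζ‖ := hζ
      nlinarith
    · simp [indicator_of_notMem hζ]
  have hz : ∫ ζ, (‖A.indicator f ζ‖ ^ 2 - ‖A.indicator f ζ‖) ∂circleMeasure = 0 := by
    refine le_antisymm ?_ (integral_nonneg hnn)
    rw [integral_sub hi2 hi1]
    linarith
  filter_upwards [(integral_eq_zero_iff_of_nonneg hnn (hi2.sub hi1)).1 hz] with ζ e
  by_contra hlt
  have hζ : ζ ∈ A := not_le.1 hlt
  simp only [indicator_of_mem hζ, Pi.zero_apply] at e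
  have : 1 < ‖f ζ‖ := hζ
  nlinarith

/-- Hahn-Banach in `L¹`, followed by the Riesz representation in `L²`: the functional prescribed on
`E ⊓ Hᗮ` and on the kernel functions encodes membership in `H` and the values at the `z_j`. -/
theorem exists_interpolation {n : ℕ} {z : Fin n → 𝔻} {w : Fin n → ℂ}
    (hA : ∀ (σ : Γ →* Circle) (d : Fin n → ℂ),
      ‖∑ j, (d j * conj (w j)) • kernelFun σ (z j)‖ ≤ ‖∑ j, d j • kernelFun σ (z j)‖) :
    ∃ f ∈ HardyInv ∞ Γ, ‖f‖ ≤ 1 ∧ ∀ j, valueAt (z j) f = w j := by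
  set E := invariantL2 Γ
  set H := HardyInv 2 Γ with hH
  set κ : Fin n → Lp ℂ 2 circleMeasure := fun j => kernelFun (1 : Γ →* Circle) (z j) with hκ
  let Φ : (E ⊓ Hᗮ : Submodule ℂ (Lp ℂ 2 circleMeasure)) × (Fin n → ℂ) →ₗ[ℂ] Lp ℂ 2 circleMeasure :=
    (E ⊓ Hᗮ).subtype.coprod (Fintype.linearCombination ℂ κ)
  let ℓ : (E ⊓ Hᗮ : Submodule ℂ (Lp ℂ 2 circleMeasure)) × (Fin n → ℂ) →ₗ[ℂ] ℂ :=
    (Fintype.linearCombination ℂ fun j => conj (w j)) ∘ₗ LinearMap.snd ℂ _ _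
  have hΦ : ∀ m c, Φ (m, c) = m + ∑ j, c j • κ j := fun m c => rfl
  have hℓ : ∀ m c, ℓ (m, c) = ∑ j, c j * conj (w j) := fun m c => rfl
  have hbound : ∀ x, ‖ℓ x‖ ≤ ‖(inclL1 ∘ₗ Φ) x‖ := by
    rintro ⟨m, c⟩
    rw [hℓ]
    refine le_of_le_of_eq ?_ (norm_inclL1 (Φ (m, c))).symm
    refine norm_sum_le_integral hA (v := Φ (m, c)) ?_ fun F hF => ?_
    · rw [hΦ]
      exact add_mem m.2.1 (hardyInv_le_invariantL2 (sum_kernelFun_mem _ z c))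
    · rw [hΦ, inner_add_right, inner_sum_kernelFun z c hF, m.2.2 F hF, zero_add]
  obtain ⟨L, hL1, hL⟩ := exists_functional_comp_eq (inclL1 ∘ₗ Φ) ℓ hbound
  let L2 : Lp ℂ 2 circleMeasure →L[ℂ] ℂ := L ∘L inclL1.mkContinuous 1 fun f => by
    rw [one_mul]; exact norm_inclL1_le f
  have hL2 : ∀ v, ‖L2 v‖ ≤ ∫ ζ, ‖v ζ‖ ∂circleMeasure := fun v => by
    rw [← norm_inclL1]
    exact (L.le_opNorm _).trans (mul_le_of_le_one_left (norm_nonneg _) hL1)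
  have hL2Φ : ∀ (m : (E ⊓ Hᗮ : Submodule ℂ (Lp ℂ 2 circleMeasure))) (c : Fin n → ℂ),
      L2 (m + ∑ j, c j • κ j) = ∑ j, c j * conj (w j) := fun m c => hL (m, c)
  set f₀ := (InnerProductSpace.toDual ℂ (Lp ℂ 2 circleMeasure)).symm L2 with hf₀
  have hf₀L : ∀ v, ⟪f₀, v⟫_ℂ = L2 v := fun v => InnerProductSpace.toDual_symm_apply
  -- The Hahn-Banach extension need not be represented by an invariant function; projecting to `E`
  -- makes it so and keeps its action on `E`.
  set f := E.starProjection f₀ with hf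
  have hfE : f ∈ E := E.starProjection_apply_mem f₀
  have hfL : ∀ v ∈ E, ⟪f, v⟫_ℂ = L2 v := fun v hv => by
    rw [← hf₀L, hf, ← sub_eq_zero, ← inner_sub_left, ← neg_sub, inner_neg_left,
      neg_eq_zero]
    exact Submodule.inner_left_of_mem_orthogonal hv (E.sub_starProjection_mem_orthogonal f₀)
  have hfb : ∀ᵐ ζ ∂circleMeasure, ‖f ζ‖ ≤ 1 := ae_norm_le_one_of_inner_le hfE fun v hv => by
    rw [hfL v hv]; exact hL2 v
  have hfH : f ∈ H := by
    -- The functional vanishes on `E ⊓ Hᗮ`, hence on the component of `f` orthogonal to `H`, which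
    -- is therefore orthogonal to itself.
    have h1 : f - H.starProjection f ∈ E ⊓ Hᗮ :=
      ⟨sub_mem hfE (hardyInv_le_invariantL2 (H.starProjection_apply_mem f)),
        H.sub_starProjection_mem_orthogonal f⟩
    have h2 : ⟪f, f - H.starProjection f⟫_ℂ = 0 := by
      rw [hfL _ h1.1]
      simpa using hL2Φ ⟨_, h1⟩ 0
    have h3 : ⟪H.starProjection f, f - H.starProjection f⟫_ℂ = 0 :=
      h1.2 _ (H.starProjection_apply_mem f)
    have h4 : f - H.starProjection f = 0 := by
      rw [← inner_self_eq_zero (𝕜 := ℂ), inner_sub_left, h2, h3, sub_zero]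
    rw [sub_eq_zero.1 h4]
    exact H.starProjection_apply_mem f
  have hfw : ∀ j, valueAt (z j) f = w j := fun j => by
    have h1 := inner_kernelFun (z j) hfH
    have h2 := hL2Φ 0 (Pi.single j 1)
    have h3 : ∑ i, (Pi.single j 1 : Fin n → ℂ) i • κ i = κ j := by simp [Pi.single_apply]
    rw [h3, ZeroMemClass.coe_zero, zero_add, ← hfL _
      (hardyInv_le_invariantL2 (kernelFun_mem _ (z j))), h1] at h2
    have h4 : conj (valueAt (z j) f) = conj (w j) := by
      rw [h2]; simp [Pi.single_apply]
    simpa using congrArg conj h4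
  have hm : MemLp f ∞ circleMeasure := MemLp.of_bound (Lp.aestronglyMeasurable f) 1 hfb
  have hae := hm.coeFn_toLp
  refine ⟨hm.toLp f, ⟨((isHardy_coe hfH.1).congr hae.symm).2,
    IsAutomorphic.congr hfH.2 hae.symm⟩, ?_, fun j => (valueAt_congr hae _).trans (hfw j)⟩
  simpa using Lp.norm_le_of_ae_bound zero_le_one (f := hm.toLp f) (by
    filter_upwards [hfb, hae] with ζ h1 h2; rwa [h2])

end FuchsianHardy

end

/-- The Nevanlinna-Pick interpolation theorem for `H^∞_Γ`. The factorization of invariant functions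
through outer functions that are bounded above and below works for every group `Γ`, so the proof
does not use the admissibility of `Γ`. -/
theorem mainTheorem2 (Γ : Subgroup FuchsianHardy.DiscAut) (hΓ : FuchsianHardy.Admissible Γ)
    (n : ℕ) (z : Fin n → 𝔻) (w : Fin n → ℂ) :
    (∃ f ∈ FuchsianHardy.HardyInv ∞ Γ, ‖f‖ ≤ 1 ∧
        ∀ j, FuchsianHardy.valueAt (z j) f = w j) ↔
      ∀ σ : Γ →* Circle,
        (Matrix.of fun i j =>
          (1 - w i * conj (w j)) * FuchsianHardy.kernelChar σ (z i) (z j)).PosSemidef := by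
  constructor
  · rintro ⟨f, hf, hf1, hfw⟩ σ
    exact (FuchsianHardy.posSemidef_pick_iff z w).2
      (FuchsianHardy.norm_sum_kernelFun_le_of_interpolation hf hf1 hfw σ)
  · intro h
    exact FuchsianHardy.exists_interpolation fun σ =>
      (FuchsianHardy.posSemidef_pick_iff z w).1 (h σ)
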